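/- Let $\mathtt A$ be a finite set, $d\ge 1$, and let $X\subset \mathtt A^{\mathbb Z^d}$ be a shift space, i.e. a closed set invariant under the translations $(T^jx)(k)=x(k+j)$, $j\in\mathbb Z^d$. Write $\Lambda_m=\{i\in\mathbb Z^d: |i_k|\le m \text{ for all } k\}$ and, for $x\in X$, $B_m(x)=\{y\in X: y=x \text{ on } \Lambda_m\}$. Let $X_n$ be the set of restrictions to $\Lambda_n$ of points of $X$. The pressure of $\psi\in C(X)$ is $$P(\psi)=\limsup_{n\to\infty}\frac1{|\Lambda_n|}\ln\sum_{u\in X_n}\ \sup_{x\in X,\ x|_{\Lambda_n}=u}\exp\sum_{j\in\Lambda_n}\psi(T^jx).$$ A translation invariant Borel probability measure $\nu$ on $X$ is a tangent functional to the pressure at $\varphi\in C(X)$ if $P(\varphi+f)\ge P(\varphi)+\int f\,d\nu$ for all $f\in C(X)$. A Borel probability measure $\nu$ on $X$ is a weak Gibbs measure for $\psi\in C(X)$ if for every $\delta>0$ there is $N_\delta$ such that for all $m\ge N_\delta$ $$\sup_{x\in X}\Big|\frac1{|\Lambda_m|}\ln\nu(B_m(x))-\frac1{|\Lambda_m|}\sum_{j\in\Lambda_m}\psi(T^jx)\Big|\le\delta$$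 (in particular $\nu(B_m(x))>0$ for these $m$ and all $x\in X$). An absolutely summable potential $\Phi$ is a family of continuous functions $\Phi_A:X\to\mathbb R$, indexed by the finite sets $A\subset\mathbb Z^d$, such that $\Phi_A(x)$ depends only on the restriction of $x$ to $A$, $\Phi_A\circ T^a=\Phi_{A+a}$ for all $a\in\mathbb Z^d$, and $\sum_{A\ni 0}\|\Phi_A\|_\infty<\infty$. Put $\varphi_\Phi=\sum_{A\ni0}\Phi_A/|A|\in C(X)$. $X$ satisfies the decoupling condition if there is $q:\mathbb N\to\mathbb N$ with $q_m/m\to0$ such that for all $m\in\mathbb N$ and $x,y\in X$ there are $z\in X$ and $\ell\in\Lambda_{q_m}$ with $T^{-\ell}z=y$ on $\Lambda_m$ and $z=x$ on $\mathbb Z^d\setminus\Lambda_{m+q_m}$. For $d=1$, $X$ satisfies the 1-decoupling condition if there is $\bar q:\mathbb N\to\mathbb N$ with $\bar q_m/m\to0$ such that for all $m\in\mathbb N$ and $x^-,y,x^+\in X$ there are integers $\ell^-,\ell^+$ with $|\ell^\pm|\le\bar q_m$ and $z\in X$ with $z=y$ on $[-m,m]$, $z=T^{-\ell^-}x^-$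 on $(-\infty,-m-\bar q_m)$ and $z=T^{-\ell^+}x^+$ on $(m+\bar q_m,\infty)$. **Theorem.** (i) If $X\subset\mathtt A^{\mathbb Z^d}$ satisfies the decoupling condition and $\Phi$ is an absolutely summable potential, then every tangent functional $\nu$ to the pressure at $\varphi_\Phi$ is a weak Gibbs measure for $\varphi_\Phi-P(\varphi_\Phi)$. (ii) If $d=1$, the same conclusion holds when $X$ satisfies the 1-decoupling condition and $\Phi$ is an absolutely summable potential such that in addition $$\|\Phi\|'=\sum_{\substack{A\subset[-1,1]^c\\ A\cap(-\infty,-1)\ne\emptyset,\ A\cap(1,\infty)\ne\emptyset}}\|\Phi_A\|_\infty<\infty .$$ -/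

import Mathlib

open MeasureTheory Filter Topology SymbolicDynamics.FullShift

namespace WeakGibbs

noncomputable section

/-- The lattice `ℤ^d`. -/
abbrev Lattice (d : ℕ) : Type := Fin d → ℤ

/-- The box `Λ_m = {i ∈ ℤ^d : |i_k| ≤ m for all k}`. -/
def box (d m : ℕ) : Finset (Lattice d) :=
  Fintype.piFinset fun _ => Finset.Icc (-(m : ℤ)) (m : ℤ)

theorem mem_box {d m : ℕ} {i : Lattice d} : i ∈ box d m ↔ ∀ k, |i k| ≤ (m : ℤ) := by
  simp [box, abs_le]

/-- A shift space `X ⊆ A^(ℤ^d)`: a closed translation invariant set of configurations. -/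
abbrev ShiftSpace (d : ℕ) (A : Type*) [TopologicalSpace A] := Subshift A (Lattice d)

section

variable {d : ℕ} {A : Type*} [TopologicalSpace A]

/-- The points of a shift space, with the topology and σ-algebra induced from the product. -/
abbrev Pt (X : ShiftSpace d A) : Type _ := {x : Lattice d → A // x ∈ X.carrier}

/-- The action of `ℤ^d` on a shift space: `(T^j x)(k) = x(k + j)`. -/
def T {X : ShiftSpace d A} (j : Lattice d) (x : Pt X) : Pt X :=
  ⟨shift j x.1, X.mapsTo j x.2⟩

theorem T_apply {X : ShiftSpace d A} (j : Lattice d) (x : Pt X) (k : Lattice d) :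
    (T j x).1 k = x.1 (k + j) := by
  rw [add_comm]; rfl

instance [Finite A] (X : ShiftSpace d A) : CompactSpace (Pt X) :=
  isCompact_iff_compactSpace.mp X.isClosed.isCompact

/-- The set `X_n` of restrictions to `Λ_n` of the points of `X`. -/
def patterns [Finite A] (X : ShiftSpace d A) (n : ℕ) : Finset (box d n → A) :=
  (Set.toFinite (Set.range fun x : Pt X => (box d n).restrict x.1)).toFinset

/-- `⟨ℰ_m(x), ψ⟩`, the integral of `ψ` with respect to the empirical measure
`|Λ_m|⁻¹ ∑_{j ∈ Λ_m} δ_{T^j x}`. -/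
def empiricalMean {X : ShiftSpace d A} (m : ℕ) (x : Pt X) (ψ : C(Pt X, ℝ)) : ℝ :=
  ((box d m).card : ℝ)⁻¹ * ∑ j ∈ box d m, ψ (T j x)

/-- The topological pressure of a continuous function on a shift space:
`P(ψ) = limsup_n |Λ_n|⁻¹ log ∑_{u ∈ X_n} sup {exp (∑_{j ∈ Λ_n} ψ(T^j x)) : x ∈ X, x|Λ_n = u}`. -/
def pressure [Finite A] {X : ShiftSpace d A} (ψ : C(Pt X, ℝ)) : ℝ :=
  limsup (fun n : ℕ => ((box d n).card : ℝ)⁻¹ * Real.log (∑ u ∈ patterns X n,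
    ⨆ x : {x : Pt X // (box d n).restrict x.1 = u},
      Real.exp (∑ j ∈ box d n, ψ (T j x.1)))) atTop

/-- Absolutely summable potentials on a shift space. -/
structure Potential [Finite A] (X : ShiftSpace d A) where
  /-- the interaction `Φ_S` of the finite set `S` of sites -/
  toFun : Finset (Lattice d) → C(Pt X, ℝ)
  isLocal : ∀ (S : Finset (Lattice d)) (x y : Pt X),
    Set.EqOn x.1 y.1 (S : Set (Lattice d)) → toFun S x = toFun S y
  translation : ∀ (S : Finset (Lattice d)) (a : Lattice d) (x : Pt X),
    toFun S (T a x) = toFun (S.map (addRightEmbedding a)) x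
  summable : Summable fun S : {S : Finset (Lattice d) // 0 ∈ S} => ‖toFun S.1‖

/-- The continuous function `φ_Φ = ∑_{S ∋ 0} Φ_S / |S|`. -/
def Potential.phi [Finite A] {X : ShiftSpace d A} (Φ : Potential X) : C(Pt X, ℝ) where
  toFun x := ∑' S : {S : Finset (Lattice d) // 0 ∈ S}, Φ.toFun S.1 x / (S.1.card : ℝ)
  continuous_toFun := by
    refine continuous_tsum (fun S => (Φ.toFun S.1).continuous.div_const _) Φ.summable ?_
    intro S x
    have h1 : (1 : ℝ) ≤ (S.1.card : ℝ) := by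
      exact_mod_cast Finset.card_pos.mpr ⟨0, S.2⟩
    rw [norm_div, Real.norm_natCast]
    exact (div_le_self (norm_nonneg _) h1).trans ((Φ.toFun S.1).norm_coe_le_norm x)

/-- The cylinder set `B_m(x)` of the points of `X` that agree with `x` on `Λ_m`. -/
def B {X : ShiftSpace d A} (m : ℕ) (x : Pt X) : Set (Pt X) :=
  {y | Set.EqOn y.1 x.1 (box d m : Set (Lattice d))}

/-- `ν` is a weak Gibbs measure for `ψ`. The positivity says that `ln ν(B_m(x))` is finite. -/
def IsWeakGibbs [MeasurableSpace A] {X : ShiftSpace d A} (ν : Measure (Pt X))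
    (ψ : C(Pt X, ℝ)) : Prop :=
  IsProbabilityMeasure ν ∧
    ∀ δ : ℝ, 0 < δ → ∃ N : ℕ, ∀ m : ℕ, N ≤ m → ∀ x : Pt X,
      0 < ν (B m x) ∧
        |((box d m).card : ℝ)⁻¹ * Real.log (ν.real (B m x)) - empiricalMean m x ψ| ≤ δ

/-- `ν` is a translation invariant probability measure that is a tangent functional to the
pressure at `φ`. -/
structure IsTangentFunctional [Finite A] [MeasurableSpace A] {X : ShiftSpace d A}
    (ν : Measure (Pt X)) (φ : C(Pt X, ℝ)) : Prop where
  isProbabilityMeasure : IsProbabilityMeasure ν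
  invariant : ∀ j : Lattice d, MeasurePreserving (T j) ν ν
  tangent : ∀ f : C(Pt X, ℝ), pressure φ + ∫ x, f x ∂ν ≤ pressure (φ + f)

/-- The decoupling condition. -/
def Decoupling (X : ShiftSpace d A) : Prop :=
  ∃ q : ℕ → ℕ, Tendsto (fun m : ℕ => (q m : ℝ) / (m : ℝ)) atTop (𝓝 0) ∧
    ∀ (m : ℕ) (x y : Pt X), ∃ z : Pt X, ∃ l ∈ box d (q m),
      Set.EqOn (T (-l) z).1 y.1 (box d m : Set (Lattice d)) ∧
      Set.EqOn z.1 x.1 ((box d (m + q m) : Set (Lattice d))ᶜ)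

/-- The 1-decoupling condition, for shift spaces over `ℤ`. -/
def OneDecoupling (X : ShiftSpace 1 A) : Prop :=
  ∃ q : ℕ → ℕ, Tendsto (fun m : ℕ => (q m : ℝ) / (m : ℝ)) atTop (𝓝 0) ∧
    ∀ (m : ℕ) (xm y xp : Pt X), ∃ lm ∈ box 1 (q m), ∃ lp ∈ box 1 (q m), ∃ z : Pt X,
      Set.EqOn z.1 y.1 (box 1 m : Set (Lattice 1)) ∧
      Set.EqOn z.1 (T (-lm) xm).1 {k | k 0 < -(m : ℤ) - (q m : ℤ)} ∧
      Set.EqOn z.1 (T (-lp) xp).1 {k | (m : ℤ) + (q m : ℤ) < k 0}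

/-- The finite sets of integers `S ⊆ [-1,1]ᶜ` that meet both `(-∞,-1)` and `(1,∞)`. -/
def IsCrossing (S : Finset (Lattice 1)) : Prop :=
  (∀ k ∈ S, k 0 < -1 ∨ 1 < k 0) ∧ (∃ k ∈ S, k 0 < -1) ∧ ∃ k ∈ S, 1 < k 0

/-- `‖Φ‖' = ∑ ‖Φ_S‖ < ∞`, the sum over the finite `S ⊆ [-1,1]ᶜ` with sites on both sides
of `[-1,1]`. -/
def Potential.CrossSummable [Finite A] {X : ShiftSpace 1 A} (Φ : Potential X) : Prop :=
  Summable fun S : {S : Finset (Lattice 1) // IsCrossing S} => ‖Φ.toFun S.1‖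

end

end

end WeakGibbs

/-! Tangency is tested with f = (s/|Λ_M|)·1_D for a clopen set D. This bounds s·ν(D) by
|Λ_M|·(P(φ+f) − P(φ)), so upper bounds for perturbed partition functions suffice. By convexity the
perturbing factor on Λ_n is at most an average, over the residue classes mod 2M+1, of products of
exp(s·1_D∘T^j) over disjoint tiles j+Λ_M (`exp_birk_ind_le`). The factors are removed one at a time,
latest tile first (`wsum_prod_le`). If each removal costs at most e^θ, then s·ν(D) ≤ θ
(`IsTangentFunctional.mul_measure_le`).

A single factor is handled by surgery on configurations (`Replaceable`). Overwriting the pattern of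
x at j by all patterns bounds the share of the total weight carried by D = B_m(x) from above.
Inserting the pattern of x bounds the share carried by the union of the translates of B_m(x) from
below. Small s of either sign turns these shares into bounds on ν, and invariance leads from the
union back to B_m(x). Hence ln ν(B_m(x)) = ∑ φ(T^j x) − ln Z_m + o(|Λ_m|). Moreover ln Z_m = |Λ_m| P
+ o(|Λ_m|): one inequality is subadditivity (`pressure_le_press`), the other is tile removal along a
fixed point (`Replaceable.log_Z_le`).

Decoupling allows surgery that changes x only inside j+Λ_M. Under 1-decoupling the part to the right
of the tile is also translated, so only the past of j is preserved; this is why the tiles are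
ordered. The cost consists of the number of translations, the buffer around the inserted pattern,
and the energy. Because of the weights 1/|S| in φ_Φ, summing over sites counts each S at most once
(`Potential.sum_tsum_le`). Only sets S that meet both the tile and its complement matter, with total
weight o(|Λ_M|), and, under 1-decoupling, sets that jump over the tile, with total weight at most
‖Φ‖'. -/

namespace WeakGibbs

noncomputable section

/-! ### Translates, boxes, and partition functions as finite sums over points. -/

section Basic

variable {d : ℕ} {A : Type*} [TopologicalSpace A] {X : ShiftSpace d A}

theorem T_zero (x : Pt X) : T 0 x = x := by
  apply Subtype.ext; funext k; rw [T_apply, add_zero]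

theorem T_T (a b : Lattice d) (x : Pt X) : T a (T b x) = T (a + b) x := by
  apply Subtype.ext; funext k; simp only [T_apply, add_assoc]

theorem continuous_T (a : Lattice d) : Continuous (T a : Pt X → Pt X) := by
  refine Continuous.subtype_mk (continuous_pi fun k => ?_) _
  exact (continuous_apply (a + k)).comp continuous_subtype_val

/-- The sum of `ψ` along the translates `T^j x`, `j ∈ V`. -/
def birk (ψ : C(Pt X, ℝ)) (V : Finset (Lattice d)) (x : Pt X) : ℝ := ∑ j ∈ V, ψ (T j x)

theorem continuous_birk (ψ : C(Pt X, ℝ)) (V : Finset (Lattice d)) :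
    Continuous (birk ψ V) :=
  continuous_finsetSum _ fun j _ => ψ.continuous.comp (continuous_T j)

theorem birk_add (ψ f : C(Pt X, ℝ)) (V : Finset (Lattice d)) (x : Pt X) :
    birk (ψ + f) V x = birk ψ V x + birk f V x := by
  simp [birk, Finset.sum_add_distrib]

theorem birk_union (ψ : C(Pt X, ℝ)) {V W : Finset (Lattice d)} (h : Disjoint V W) (x : Pt X) :
    birk ψ (V ∪ W) x = birk ψ V x + birk ψ W x :=
  Finset.sum_union h

theorem birk_map (ψ : C(Pt X, ℝ)) (V : Finset (Lattice d)) (a : Lattice d) (x : Pt X) :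
    birk ψ (V.map (addRightEmbedding a)) x = birk ψ V (T a x) := by
  simp [birk, T_T]

/-- The translate `j + Λ_m` of the box `Λ_m`. -/
def tbox (j : Lattice d) (m : ℕ) : Finset (Lattice d) := (box d m).map (addRightEmbedding j)

theorem mem_tbox {j k : Lattice d} {m : ℕ} : k ∈ tbox j m ↔ ∀ c, |k c - j c| ≤ (m : ℤ) := by
  simp only [tbox, Finset.mem_map, mem_box, addRightEmbedding_apply]
  constructor
  · rintro ⟨i, hi, rfl⟩ c
    simpa using hi c
  · intro h
    exact ⟨k - j, by simpa using h, by simp⟩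

theorem card_tbox (j : Lattice d) (m : ℕ) : (tbox j m).card = (box d m).card :=
  Finset.card_map _

theorem card_box (d m : ℕ) : (box d m).card = (2 * m + 1) ^ d := by
  simp only [box, Fintype.card_piFinset, Int.card_Icc, Finset.prod_const, Finset.card_univ,
    Fintype.card_fin]
  congr 1
  omega

theorem card_box_pos (d m : ℕ) : 0 < (box d m).card := by
  rw [card_box]; positivity

theorem box_mono {m n : ℕ} (h : m ≤ n) : box d m ⊆ box d n := by
  intro k hk
  rw [mem_box] at hk ⊢
  exact fun c => (hk c).trans (by exact_mod_cast h)

theorem tbox_mono (j : Lattice d) {m n : ℕ} (h : m ≤ n) : tbox j m ⊆ tbox j n :=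
  Finset.map_subset_map.mpr (box_mono h)

theorem birk_tbox (ψ : C(Pt X, ℝ)) (j : Lattice d) (m : ℕ) (x : Pt X) :
    birk ψ (tbox j m) x = birk ψ (box d m) (T j x) := birk_map ψ _ j x

theorem eqOn_T_box_iff {j : Lattice d} {m : ℕ} {x y : Pt X} :
    Set.EqOn (T j x).1 (T j y).1 (box d m : Set (Lattice d)) ↔
      Set.EqOn x.1 y.1 (tbox j m : Set (Lattice d)) := by
  constructor
  · intro h k hk
    have : k - j ∈ box d m := by
      rw [Finset.mem_coe, mem_tbox] at hk; rw [mem_box]; exact hk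
    have := h this
    simpa [T_apply] using this
  · intro h k hk
    rw [T_apply, T_apply]
    exact h (by rw [Finset.mem_coe, mem_tbox]; simpa [mem_box] using hk)

theorem restrict_eq_iff {α : Type*} {V : Finset (Lattice d)} {x y : Lattice d → α} :
    V.restrict x = V.restrict y ↔ Set.EqOn x y (V : Set (Lattice d)) := by
  simp [funext_iff, Set.EqOn]

section Discrete

variable [DiscreteTopology A]

theorem isClosed_eqOn (V : Finset (Lattice d)) (x : Pt X) :
    IsClosed {y : Pt X | Set.EqOn y.1 x.1 (V : Set (Lattice d))} := by
  have : {y : Pt X | Set.EqOn y.1 x.1 (V : Set (Lattice d))} =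
      ⋂ k ∈ V, (fun y : Pt X => y.1 k) ⁻¹' {x.1 k} := by
    ext y; simp [Set.EqOn]
  rw [this]
  exact isClosed_biInter fun k _ => (isClosed_discrete _).preimage
    ((continuous_apply k).comp continuous_subtype_val)

theorem isOpen_eqOn (V : Finset (Lattice d)) (x : Pt X) :
    IsOpen {y : Pt X | Set.EqOn y.1 x.1 (V : Set (Lattice d))} := by
  have : {y : Pt X | Set.EqOn y.1 x.1 (V : Set (Lattice d))} =
      ⋂ k ∈ V, (fun y : Pt X => y.1 k) ⁻¹' {x.1 k} := by
    ext y; simp [Set.EqOn]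
  rw [this]
  exact isOpen_biInter_finset fun k _ => (isOpen_discrete _).preimage
    ((continuous_apply k).comp continuous_subtype_val)

end Discrete

section Compact

variable [Finite A]

theorem abs_le_norm (ψ : C(Pt X, ℝ)) (x : Pt X) : |ψ x| ≤ ‖ψ‖ := by
  rw [← Real.norm_eq_abs]; exact ψ.norm_coe_le_norm x

theorem abs_birk_le (ψ : C(Pt X, ℝ)) (V : Finset (Lattice d)) (x : Pt X) :
    |birk ψ V x| ≤ V.card * ‖ψ‖ := by
  refine (Finset.abs_sum_le_sum_abs _ _).trans ?_
  rw [← nsmul_eq_mul]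
  exact Finset.sum_le_card_nsmul _ _ _ fun j _ => abs_le_norm ψ _

theorem birk_le_add_of_subset (ψ : C(Pt X, ℝ)) {V W : Finset (Lattice d)} (h : V ⊆ W) (x : Pt X) :
    |birk ψ W x - birk ψ V x| ≤ ((W.card : ℝ) - V.card) * ‖ψ‖ := by
  have h1 : birk ψ W x = birk ψ (W \ V) x + birk ψ V x := (Finset.sum_sdiff h).symm
  rw [h1, add_sub_cancel_right]
  refine (abs_birk_le ψ _ x).trans (le_of_eq ?_)
  rw [Finset.cast_card_sdiff h]

variable [DiscreteTopology A]

/-- Cylinders are closed in a compact space, so the supremum in the pressure is attained. Choosing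
one maximiser per pattern makes partition functions sums over points of X, on which surgery can act.
-/
theorem exists_reps (ψ : C(Pt X, ℝ)) (V : Finset (Lattice d)) :
    ∃ R : Finset (Pt X),
      (∀ x, ∃ r ∈ R, Set.EqOn r.1 x.1 (V : Set (Lattice d)) ∧ birk ψ V x ≤ birk ψ V r) ∧
      ∀ r ∈ R, ∀ r' ∈ R, Set.EqOn r.1 r'.1 (V : Set (Lattice d)) → r = r' := by
  have key : ∀ p : Set.range (fun x : Pt X => V.restrict x.1), ∃ r : Pt X, V.restrict r.1 = p.1 ∧
      ∀ x : Pt X, V.restrict x.1 = p.1 → birk ψ V x ≤ birk ψ V r := by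
    rintro ⟨p, x, rfl⟩
    obtain ⟨r, hr, hmax⟩ := (isClosed_eqOn V x).isCompact.exists_isMaxOn
      ⟨x, fun _ _ => rfl⟩ (continuous_birk ψ V).continuousOn
    refine ⟨r, ?_, fun y hy => hmax ?_⟩
    · exact restrict_eq_iff.mpr hr
    · exact restrict_eq_iff.mp hy
  choose f hf hmax using key
  refine ⟨(Set.toFinite (Set.range f)).toFinset, fun x => ?_, ?_⟩
  · refine ⟨f ⟨V.restrict x.1, x, rfl⟩, by simp, ?_, hmax _ x rfl⟩
    exact restrict_eq_iff.mp (hf ⟨V.restrict x.1, x, rfl⟩)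
  · simp only [Set.Finite.mem_toFinset, Set.mem_range]
    rintro _ ⟨p, rfl⟩ _ ⟨p', rfl⟩ h
    congr 1
    apply Subtype.ext
    rw [← hf p, ← hf p']
    exact restrict_eq_iff.mpr h

/-- One point for every pattern on `V`, which maximises `birk ψ V` among the points with this
pattern. -/
def reps (ψ : C(Pt X, ℝ)) (V : Finset (Lattice d)) : Finset (Pt X) := (exists_reps ψ V).choose

theorem exists_mem_reps (ψ : C(Pt X, ℝ)) (V : Finset (Lattice d)) (x : Pt X) :
    ∃ r ∈ reps ψ V, Set.EqOn r.1 x.1 (V : Set (Lattice d)) ∧ birk ψ V x ≤ birk ψ V r :=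
  (exists_reps ψ V).choose_spec.1 x

theorem reps_inj {ψ : C(Pt X, ℝ)} {V : Finset (Lattice d)} {r r' : Pt X} (h : r ∈ reps ψ V)
    (h' : r' ∈ reps ψ V) (e : Set.EqOn r.1 r'.1 (V : Set (Lattice d))) : r = r' :=
  (exists_reps ψ V).choose_spec.2 r h r' h' e

/-- The representative of the pattern of `x` on `V`. -/
def rep (ψ : C(Pt X, ℝ)) (V : Finset (Lattice d)) (x : Pt X) : Pt X :=
  (exists_mem_reps ψ V x).choose

theorem rep_mem (ψ : C(Pt X, ℝ)) (V : Finset (Lattice d)) (x : Pt X) : rep ψ V x ∈ reps ψ V :=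
  (exists_mem_reps ψ V x).choose_spec.1

theorem rep_eqOn (ψ : C(Pt X, ℝ)) (V : Finset (Lattice d)) (x : Pt X) :
    Set.EqOn (rep ψ V x).1 x.1 (V : Set (Lattice d)) :=
  (exists_mem_reps ψ V x).choose_spec.2.1

theorem birk_le_rep (ψ : C(Pt X, ℝ)) (V : Finset (Lattice d)) (x : Pt X) :
    birk ψ V x ≤ birk ψ V (rep ψ V x) :=
  (exists_mem_reps ψ V x).choose_spec.2.2

theorem eqOn_of_rep_eq {ψ : C(Pt X, ℝ)} {V : Finset (Lattice d)} {x y : Pt X}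
    (h : rep ψ V x = rep ψ V y) : Set.EqOn x.1 y.1 (V : Set (Lattice d)) :=
  (rep_eqOn ψ V x).symm.trans (h ▸ rep_eqOn ψ V y)

theorem rep_eq_of_eqOn {ψ : C(Pt X, ℝ)} {V : Finset (Lattice d)} {x y : Pt X}
    (h : Set.EqOn x.1 y.1 (V : Set (Lattice d))) : rep ψ V x = rep ψ V y :=
  reps_inj (rep_mem ψ V x) (rep_mem ψ V y)
    ((rep_eqOn ψ V x).trans (h.trans (rep_eqOn ψ V y).symm))

/-- The sum of `G` over the patterns on `V` with Boltzmann weights. -/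
def wsum (ψ : C(Pt X, ℝ)) (V : Finset (Lattice d)) (G : Pt X → ℝ) : ℝ :=
  ∑ r ∈ reps ψ V, Real.exp (birk ψ V r) * G r

/-- The partition function of the finite volume `V`. -/
def Z (ψ : C(Pt X, ℝ)) (V : Finset (Lattice d)) : ℝ := ∑ r ∈ reps ψ V, Real.exp (birk ψ V r)

theorem wsum_one (ψ : C(Pt X, ℝ)) (V : Finset (Lattice d)) : wsum ψ V 1 = Z ψ V := by
  simp [wsum, Z]

theorem wsum_nonneg (ψ : C(Pt X, ℝ)) (V : Finset (Lattice d)) {G : Pt X → ℝ} (h : 0 ≤ G) :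
    0 ≤ wsum ψ V G :=
  Finset.sum_nonneg fun r _ => mul_nonneg (Real.exp_pos _).le (h r)

theorem exp_birk_le_Z (ψ : C(Pt X, ℝ)) (V : Finset (Lattice d)) (x : Pt X) :
    Real.exp (birk ψ V x) ≤ Z ψ V :=
  (Real.exp_le_exp.mpr (birk_le_rep ψ V x)).trans
    (Finset.single_le_sum (f := fun r => Real.exp (birk ψ V r))
      (fun _ _ => (Real.exp_pos _).le) (rep_mem ψ V x))

theorem Z_pos [Nonempty (Pt X)] (ψ : C(Pt X, ℝ)) (V : Finset (Lattice d)) : 0 < Z ψ V :=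
  (Real.exp_pos _).trans_le (exp_birk_le_Z ψ V (Classical.arbitrary _))

theorem pressure_sum_eq_Z (ψ : C(Pt X, ℝ)) (n : ℕ) :
    ∑ u ∈ patterns X n, ⨆ x : {x : Pt X // (box d n).restrict x.1 = u},
      Real.exp (∑ j ∈ box d n, ψ (T j x.1)) = Z ψ (box d n) := by
  symm
  refine Finset.sum_bij (fun r _ => (box d n).restrict r.1) ?_ ?_ ?_ ?_
  · intro r _
    simp [patterns]
  · intro r hr r' hr' h
    exact reps_inj hr hr' (restrict_eq_iff.mp h)
  · intro u hu
    simp only [patterns, Set.Finite.mem_toFinset, Set.mem_range] at hu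
    obtain ⟨x, rfl⟩ := hu
    exact ⟨rep ψ _ x, rep_mem ψ _ x, restrict_eq_iff.mpr (rep_eqOn ψ _ x)⟩
  · intro r hr
    have : Nonempty {x : Pt X // (box d n).restrict x.1 = (box d n).restrict r.1} := ⟨⟨r, rfl⟩⟩
    have hle : ∀ x : {x : Pt X // (box d n).restrict x.1 = (box d n).restrict r.1},
        Real.exp (∑ j ∈ box d n, ψ (T j x.1)) ≤ Real.exp (birk ψ (box d n) r) := by
      intro x
      have h1 := birk_le_rep ψ (box d n) x.1
      have h2 : rep ψ (box d n) x.1 = r :=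
        reps_inj (rep_mem ψ _ _) hr ((rep_eqOn ψ _ _).trans (restrict_eq_iff.mp x.2))
      rw [h2] at h1
      exact Real.exp_le_exp.mpr h1
    apply le_antisymm
    · exact le_ciSup (f := fun x : {x : Pt X // (box d n).restrict x.1 = (box d n).restrict r.1} =>
        Real.exp (∑ j ∈ box d n, ψ (T j x.1))) ⟨_, Set.forall_mem_range.mpr hle⟩ ⟨r, rfl⟩
    · exact ciSup_le hle

/-- The finite volume pressure. -/
def press (ψ : C(Pt X, ℝ)) (n : ℕ) : ℝ := ((box d n).card : ℝ)⁻¹ * Real.log (Z ψ (box d n))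

theorem pressure_eq_limsup (ψ : C(Pt X, ℝ)) : pressure ψ = limsup (press ψ) atTop := by
  simp only [pressure, pressure_sum_eq_Z]
  rfl

end Compact

end Basic

/-! ### Packing a large box with disjoint tiles from one residue class. -/

section Tiling

variable {d : ℕ}

/-- The boxes of radius `M` around `i` and `j` are separated in some coordinate direction. -/
def Separated (M : ℕ) (i j : Lattice d) : Prop := ∃ c, 2 * (M : ℤ) + 1 ≤ |i c - j c|

theorem Separated.symm {M : ℕ} {i j : Lattice d} (h : Separated M i j) : Separated M j i := by
  obtain ⟨c, hc⟩ := h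
  exact ⟨c, by rwa [abs_sub_comm]⟩

theorem Separated.disjoint {M : ℕ} {i j : Lattice d} (h : Separated M i j) :
    Disjoint (tbox i M) (tbox j M) := by
  obtain ⟨c, hc⟩ := h
  rw [Finset.disjoint_left]
  intro k hk hk'
  have h1 := mem_tbox.mp hk c
  have h2 := mem_tbox.mp hk' c
  rw [abs_le] at h1 h2
  rcases abs_cases (i c - j c) with h3 | h3 <;> omega

/-- The sites `j` with `j + Λ_M ⊆ Λ_n`. -/
def inner (d n M : ℕ) : Finset (Lattice d) := (box d n).filter fun j => tbox j M ⊆ box d n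

/-- Representatives in `Λ_M` of the classes modulo `2M+1`. -/
def resid (M : ℕ) (j : Lattice d) : Lattice d := fun c => Int.bmod (j c) (2 * M + 1)

/-- The sites of `inner d n M` in the class of `r` modulo `2M+1`. -/
def cls (n M : ℕ) (r : Lattice d) : Finset (Lattice d) :=
  (inner d n M).filter fun j => resid M j = r

theorem resid_mem_box (M : ℕ) (j : Lattice d) : resid M j ∈ box d M := by
  rw [mem_box]
  intro c
  have h1 := Int.le_bmod (x := j c) (m := 2 * M + 1) (by omega)
  have h2 := Int.bmod_lt (x := j c) (m := 2 * M + 1) (by omega)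
  rw [abs_le]
  simp only [resid]
  push_cast at h1 h2 ⊢
  omega

theorem separated_of_mem_cls {n M : ℕ} {r i j : Lattice d} (hi : i ∈ cls n M r)
    (hj : j ∈ cls n M r) (hne : i ≠ j) : Separated M i j := by
  obtain ⟨c, hc⟩ := Function.ne_iff.mp hne
  refine ⟨c, ?_⟩
  have h1 := congrFun ((Finset.mem_filter.mp hi).2.trans (Finset.mem_filter.mp hj).2.symm) c
  have h2 : ((2 * M + 1 : ℕ) : ℤ) ∣ j c - i c := by
    rw [← Int.modEq_iff_dvd]
    have h3 : (i c).bmod (2 * M + 1) % ((2 * M + 1 : ℕ) : ℤ)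
      = (j c).bmod (2 * M + 1) % ((2 * M + 1 : ℕ) : ℤ) := by
      simp only [resid] at h1; rw [h1]
    rwa [Int.bmod_emod, Int.bmod_emod] at h3
  have h3 := Int.le_of_dvd (abs_pos.mpr (sub_ne_zero.mpr (Ne.symm hc))) ((dvd_abs _ _).mpr h2)
  rw [abs_sub_comm]
  push_cast at h3
  exact h3

theorem cls_subset_inner (n M : ℕ) (r : Lattice d) : cls n M r ⊆ inner d n M :=
  Finset.filter_subset _ _

theorem tbox_subset_of_mem_inner {n M : ℕ} {j : Lattice d} (h : j ∈ inner d n M) :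
    tbox j M ⊆ box d n := (Finset.mem_filter.mp h).2

theorem card_biUnion_tbox {n M m : ℕ} (hm : m ≤ M) (r : Lattice d) :
    ((cls n M r).biUnion fun j => tbox j m).card = (cls n M r).card * (box d m).card := by
  rw [Finset.card_biUnion]
  · simp [card_tbox]
  · intro i hi j hj hne
    exact ((separated_of_mem_cls hi hj hne).disjoint).mono (tbox_mono i hm) (tbox_mono j hm)

theorem biUnion_tbox_subset {n M m : ℕ} (hm : m ≤ M) (r : Lattice d) :
    ((cls n M r).biUnion fun j => tbox j m) ⊆ box d n :=
  Finset.biUnion_subset.mpr fun j hj =>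
    (tbox_mono j hm).trans (tbox_subset_of_mem_inner (cls_subset_inner n M r hj))

theorem card_cls_mul_le (n M : ℕ) (r : Lattice d) :
    (cls n M r).card * (box d M).card ≤ (box d n).card := by
  rw [← card_biUnion_tbox le_rfl]
  exact Finset.card_le_card (biUnion_tbox_subset le_rfl r)

theorem sum_cls {β : Type*} [AddCommMonoid β] (n M : ℕ) (f : Lattice d → β) :
    ∑ r ∈ box d M, ∑ j ∈ cls n M r, f j = ∑ j ∈ inner d n M, f j :=
  Finset.sum_fiberwise_of_maps_to (fun j _ => resid_mem_box M j) f

/-- The classes partition `inner d n M` and each has at most |Λ_n|/|Λ_M| sites. A single class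
therefore misses this bound by at most the total deficit, which is the number of sites of Λ_n
outside `inner d n M`. -/
theorem le_card_cls_mul (n M : ℕ) {r : Lattice d} (hr : r ∈ box d M) :
    ((box d n).card : ℝ) - (box d M).card * ((box d n).card - (inner d n M).card) ≤
      (cls n M r).card * (box d M).card := by
  have hK : (0 : ℝ) < (box d M).card := by exact_mod_cast card_box_pos d M
  have h1 : ∑ s ∈ box d M, ((cls n M s).card : ℝ) = (inner d n M).card := by
    have := sum_cls n M (fun _ : Lattice d => (1 : ℝ))
    simpa using this
  have h2 : ∀ s : Lattice d, ((cls n M s).card : ℝ) ≤ (box d n).card / (box d M).card := by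
    intro s
    rw [le_div_iff₀ hK]
    exact_mod_cast card_cls_mul_le n M s
  have h3 : ∑ s ∈ (box d M).erase r, ((cls n M s).card : ℝ) ≤
      ((box d M).card - 1) * ((box d n).card / (box d M).card) := by
    refine (Finset.sum_le_card_nsmul _ _ _ fun s _ => h2 s).trans (le_of_eq ?_)
    rw [Finset.card_erase_of_mem hr, nsmul_eq_mul, Nat.cast_sub (card_box_pos d M), Nat.cast_one]
  rw [← Finset.add_sum_erase _ _ hr] at h1
  have h4 : ((inner d n M).card : ℝ) - ((box d M).card - 1) * ((box d n).card / (box d M).card)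
    ≤ (cls n M r).card := by linarith
  have h5 := mul_le_mul_of_nonneg_right h4 hK.le
  refine le_trans (le_of_eq ?_) h5
  field_simp
  ring

theorem box_subset_inner {n M : ℕ} (h : M ≤ n) : box d (n - M) ⊆ inner d n M := by
  intro j hj
  rw [mem_box] at hj
  have hM : (M : ℤ) ≤ n := by exact_mod_cast h
  refine Finset.mem_filter.mpr ⟨mem_box.mpr fun c => ?_, fun k hk => mem_box.mpr fun c => ?_⟩
  · have := hj c
    rw [Nat.cast_sub h] at this
    omega
  · have h1 := hj c
    have h2 := mem_tbox.mp hk c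
    rw [Nat.cast_sub h] at h1
    rw [abs_le] at h1 h2 ⊢
    omega

theorem tendsto_card_box_ratio {a b : ℕ → ℕ}
    (h : Tendsto (fun n => (2 * (a n : ℝ) + 1) / (2 * b n + 1)) atTop (𝓝 1)) :
    Tendsto (fun n => ((box d (a n)).card : ℝ) / (box d (b n)).card) atTop (𝓝 1) := by
  have := h.pow d
  rw [one_pow] at this
  refine this.congr fun n => ?_
  simp only [card_box]
  push_cast
  rw [div_pow]

theorem tendsto_boundary (d M : ℕ) :
    Tendsto (fun n => (((box d n).card : ℝ) - (inner d n M).card) / (box d n).card) atTop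
      (𝓝 0) := by
  have h1 : Tendsto (fun n => (2 * ((n - M : ℕ) : ℝ) + 1) / (2 * n + 1)) atTop (𝓝 1) := by
    have h2 : Tendsto (fun n : ℕ => 1 - (2 * (M : ℝ)) / (2 * n + 1)) atTop (𝓝 (1 - 0)) := by
      refine tendsto_const_nhds.sub (Tendsto.const_div_atTop ?_ _)
      refine tendsto_atTop_add_const_right _ _ ?_
      exact tendsto_natCast_atTop_atTop.const_mul_atTop two_pos
    rw [sub_zero] at h2
    refine h2.congr' ?_
    filter_upwards [eventually_ge_atTop M] with n hn
    rw [Nat.cast_sub hn]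
    field_simp
    ring
  have h3 := tendsto_card_box_ratio (d := d) h1
  have h4 := h3.const_sub 1
  rw [sub_self] at h4
  refine tendsto_of_tendsto_of_tendsto_of_le_of_le' tendsto_const_nhds h4 ?_ ?_
  · refine Eventually.of_forall fun n => div_nonneg (sub_nonneg.mpr ?_) (Nat.cast_nonneg _)
    exact_mod_cast Finset.card_filter_le _ _
  · filter_upwards [eventually_ge_atTop M] with n hn
    have hK : (0 : ℝ) < (box d n).card := by exact_mod_cast card_box_pos d n
    rw [sub_div, div_self hK.ne']
    gcongr
    exact box_subset_inner hn

theorem tendsto_card_cls (M : ℕ) {r : Lattice d} (hr : r ∈ box d M) :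
    Tendsto (fun n => ((cls n M r).card : ℝ) / (box d n).card) atTop
      (𝓝 ((box d M).card : ℝ)⁻¹) := by
  have hK : (0 : ℝ) < (box d M).card := by exact_mod_cast card_box_pos d M
  have h1 := ((tendsto_boundary d M).const_sub ((box d M).card : ℝ)⁻¹)
  rw [sub_zero] at h1
  refine tendsto_of_tendsto_of_tendsto_of_le_of_le h1 tendsto_const_nhds ?_ ?_
  · intro n
    have hn : (0 : ℝ) < (box d n).card := by exact_mod_cast card_box_pos d n
    have := le_card_cls_mul n M hr
    simp only
    rw [le_div_iff₀ hn]
    refine le_of_mul_le_mul_right (le_trans (le_of_eq ?_) this) hK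
    field_simp
  · intro n
    have hn : (0 : ℝ) < (box d n).card := by exact_mod_cast card_box_pos d n
    simp only
    rw [div_le_iff₀ hn, ← div_eq_inv_mul, le_div_iff₀ hK]
    exact_mod_cast card_cls_mul_le n M r

end Tiling

/-! ### Subadditivity and comparison of the pressure with finite volumes. -/

section Pressure

theorem sum_le_sum_of_injOn {ι κ : Type*} {s : Finset ι} {t : Finset κ} (f : ι → κ)
    {a : ι → ℝ} {b : κ → ℝ} (hf : ∀ i ∈ s, f i ∈ t)
    (hinj : ∀ i ∈ s, ∀ j ∈ s, f i = f j → i = j) (hab : ∀ i ∈ s, a i ≤ b (f i))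
    (hb : ∀ k ∈ t, 0 ≤ b k) : ∑ i ∈ s, a i ≤ ∑ k ∈ t, b k := by
  classical
  calc ∑ i ∈ s, a i ≤ ∑ i ∈ s, b (f i) := Finset.sum_le_sum hab
    _ = ∑ k ∈ s.image f, b k := (Finset.sum_image fun i hi j hj h => hinj i hi j hj h).symm
    _ ≤ ∑ k ∈ t, b k := Finset.sum_le_sum_of_subset_of_nonneg
        (Finset.image_subset_iff.mpr hf) fun k hk _ => hb k hk

variable {d : ℕ} {A : Type*} [TopologicalSpace A] {X : ShiftSpace d A} [Finite A]
  [DiscreteTopology A]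

theorem Z_nonneg (ψ : C(Pt X, ℝ)) (V : Finset (Lattice d)) : 0 ≤ Z ψ V :=
  Finset.sum_nonneg fun _ _ => (Real.exp_pos _).le

/-- A pattern on V ∪ W is determined by its two restrictions, and its maximal energy is at most the
sum of theirs. No decoupling is involved. -/
theorem Z_union_le (ψ : C(Pt X, ℝ)) {V W : Finset (Lattice d)} (h : Disjoint V W) :
    Z ψ (V ∪ W) ≤ Z ψ V * Z ψ W := by
  rw [Z, Z, Z, Finset.sum_mul_sum, ← Finset.sum_product']
  refine sum_le_sum_of_injOn (fun r => (rep ψ V r, rep ψ W r)) ?_ ?_ ?_ ?_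
  · intro r _
    exact Finset.mem_product.mpr ⟨rep_mem ψ V r, rep_mem ψ W r⟩
  · intro r hr r' hr' e
    refine reps_inj hr hr' ?_
    rw [Finset.coe_union, Set.eqOn_union]
    exact ⟨eqOn_of_rep_eq (Prod.ext_iff.mp e).1, eqOn_of_rep_eq (Prod.ext_iff.mp e).2⟩
  · intro r _
    rw [birk_union ψ h, Real.exp_add]
    gcongr
    · exact birk_le_rep ψ V r
    · exact birk_le_rep ψ W r
  · intro p _
    positivity

theorem Z_tbox_le (ψ : C(Pt X, ℝ)) (j : Lattice d) (m : ℕ) : Z ψ (tbox j m) ≤ Z ψ (box d m) := by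
  refine sum_le_sum_of_injOn (fun r => rep ψ (box d m) (T j r)) (fun r _ => rep_mem _ _ _) ?_ ?_
    (fun _ _ => (Real.exp_pos _).le)
  · intro r hr r' hr' e
    exact reps_inj hr hr' (eqOn_T_box_iff.mp (eqOn_of_rep_eq e))
  · intro r _
    rw [birk_tbox]
    exact Real.exp_le_exp.mpr (birk_le_rep ψ _ _)

theorem Z_le_pow (ψ : C(Pt X, ℝ)) (V : Finset (Lattice d)) :
    Z ψ V ≤ ((Nat.card A : ℝ) * Real.exp ‖ψ‖) ^ V.card := by
  classical
  have := Fintype.ofFinite A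
  have h1 : (reps ψ V).card ≤ Nat.card A ^ V.card := by
    have h2 : (reps ψ V).card ≤ (Finset.univ : Finset (V → A)).card := by
      refine Finset.card_le_card_of_injOn (fun r => V.restrict r.1) (fun _ _ => by simp) ?_
      intro r hr r' hr' e
      exact reps_inj hr hr' (restrict_eq_iff.mp e)
    simpa [Nat.card_eq_fintype_card] using h2
  calc Z ψ V ≤ (reps ψ V).card • Real.exp (V.card * ‖ψ‖) :=
        Finset.sum_le_card_nsmul _ _ _ fun r _ =>
          Real.exp_le_exp.mpr ((le_abs_self _).trans (abs_birk_le ψ V r))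
    _ ≤ (Nat.card A ^ V.card : ℕ) * Real.exp (V.card * ‖ψ‖) := by
        rw [nsmul_eq_mul]; gcongr
    _ = _ := by rw [mul_pow, Real.exp_nat_mul]; push_cast; rfl

theorem Z_biUnion_le (ψ : C(Pt X, ℝ)) (m : ℕ) (J : Finset (Lattice d))
    (h : ∀ i ∈ J, ∀ j ∈ J, i ≠ j → Disjoint (tbox i m) (tbox j m)) :
    Z ψ (J.biUnion fun j => tbox j m) ≤ Z ψ (box d m) ^ J.card := by
  classical
  induction J using Finset.induction_on with
  | empty => simpa using Z_le_pow ψ ∅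
  | insert a s ha ih =>
    rw [Finset.biUnion_insert, Finset.card_insert_of_notMem ha, pow_succ']
    have hd : Disjoint (tbox a m) (s.biUnion fun j => tbox j m) := by
      rw [Finset.disjoint_biUnion_right]
      intro j hj
      exact h a (Finset.mem_insert_self _ _) j (Finset.mem_insert_of_mem hj)
        fun e => ha (e ▸ hj)
    refine (Z_union_le ψ hd).trans ?_
    refine mul_le_mul (Z_tbox_le ψ a m) (ih fun i hi j hj => h i (Finset.mem_insert_of_mem hi) j
      (Finset.mem_insert_of_mem hj)) (Z_nonneg _ _) (Z_nonneg _ _)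

variable [Nonempty (Pt X)]

omit [DiscreteTopology A] in
theorem one_le_card_mul_exp (ψ : C(Pt X, ℝ)) : 1 ≤ (Nat.card A : ℝ) * Real.exp ‖ψ‖ := by
  have : Nonempty A := ⟨(Classical.arbitrary (Pt X)).1 0⟩
  have h1 : (1 : ℝ) ≤ Nat.card A := by exact_mod_cast Nat.card_pos
  have h2 : 1 ≤ Real.exp ‖ψ‖ := Real.one_le_exp (norm_nonneg _)
  nlinarith

theorem log_Z_le (ψ : C(Pt X, ℝ)) (n m : ℕ) :
    Real.log (Z ψ (box d n)) ≤ (cls n m (0 : Lattice d)).card * Real.log (Z ψ (box d m)) +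
      ((box d n).card - (cls n m (0 : Lattice d)).card * (box d m).card : ℝ) *
        Real.log ((Nat.card A : ℝ) * Real.exp ‖ψ‖) := by
  classical
  set U := (cls n m (0 : Lattice d)).biUnion fun j => tbox j m
  have hU : U ⊆ box d n := biUnion_tbox_subset le_rfl 0
  have hc := one_le_card_mul_exp ψ
  have h1 : Z ψ (box d n) ≤ Z ψ (box d m) ^ (cls n m (0 : Lattice d)).card *
      ((Nat.card A : ℝ) * Real.exp ‖ψ‖) ^ (box d n \ U).card := by
    have h2 := Z_union_le ψ (Finset.disjoint_sdiff (s := U) (t := box d n))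
    rw [Finset.union_sdiff_of_subset hU] at h2
    refine h2.trans (mul_le_mul (Z_biUnion_le ψ m _ ?_) (Z_le_pow ψ _) (Z_nonneg _ _)
      (pow_nonneg (Z_nonneg _ _) _))
    exact fun i hi j hj hne => (separated_of_mem_cls hi hj hne).disjoint
  have hZ := Z_pos ψ (box d m)
  refine (Real.log_le_log (Z_pos ψ _) h1).trans (le_of_eq ?_)
  rw [Real.log_mul (by positivity) (by positivity), Real.log_pow, Real.log_pow,
    Finset.cast_card_sdiff hU, card_biUnion_tbox le_rfl]
  push_cast
  rfl

theorem press_le (ψ : C(Pt X, ℝ)) (n : ℕ) :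
    press ψ n ≤ Real.log ((Nat.card A : ℝ) * Real.exp ‖ψ‖) := by
  have hn : (0 : ℝ) < (box d n).card := by exact_mod_cast card_box_pos d n
  rw [press, inv_mul_le_iff₀ hn, ← Real.log_pow]
  exact Real.log_le_log (Z_pos ψ _) (Z_le_pow ψ _)

theorem neg_norm_le_press (ψ : C(Pt X, ℝ)) (n : ℕ) : -‖ψ‖ ≤ press ψ n := by
  have hn : (0 : ℝ) < (box d n).card := by exact_mod_cast card_box_pos d n
  rw [press, le_inv_mul_iff₀ hn, Real.le_log_iff_exp_le (Z_pos ψ _)]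
  refine le_trans (Real.exp_le_exp.mpr ?_) (exp_birk_le_Z ψ _ (Classical.arbitrary (Pt X)))
  have := (abs_le.mp (abs_birk_le ψ (box d n) (Classical.arbitrary (Pt X)))).1
  linarith

theorem isBoundedUnder_press (ψ : C(Pt X, ℝ)) :
    IsBoundedUnder (· ≤ ·) atTop (press ψ) :=
  isBoundedUnder_of ⟨_, press_le ψ⟩

theorem isCoboundedUnder_press (ψ : C(Pt X, ℝ)) :
    IsCoboundedUnder (· ≤ ·) atTop (press ψ) :=
  (isBoundedUnder_of ⟨_, neg_norm_le_press ψ⟩ :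
    IsBoundedUnder (· ≥ ·) atTop (press ψ)).isCoboundedUnder_flip

theorem pressure_le_of_tendsto {ψ : C(Pt X, ℝ)} {u : ℕ → ℝ} {c : ℝ} (hu : Tendsto u atTop (𝓝 c))
    (h : ∀ᶠ n in atTop, press ψ n ≤ u n) : pressure ψ ≤ c := by
  rw [pressure_eq_limsup, ← hu.limsup_eq]
  exact limsup_le_limsup h (isCoboundedUnder_press ψ) hu.isBoundedUnder_le

theorem le_pressure_of_tendsto {ψ : C(Pt X, ℝ)} {u : ℕ → ℝ} {c : ℝ} (hu : Tendsto u atTop (𝓝 c))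
    (h : ∀ᶠ n in atTop, u n ≤ press ψ n) : c ≤ pressure ψ := by
  rw [pressure_eq_limsup, ← hu.limsup_eq]
  exact limsup_le_limsup h hu.isCoboundedUnder_le (isBoundedUnder_press ψ)

theorem pressure_le_add_of_tendsto {ψ φ : C(Pt X, ℝ)} {u : ℕ → ℝ} {c : ℝ}
    (hu : Tendsto u atTop (𝓝 c)) (h : ∀ᶠ n in atTop, press ψ n ≤ press φ n + u n) :
    pressure ψ ≤ pressure φ + c := by
  refine le_of_forall_pos_le_add fun δ hδ => ?_
  have h1 : ∀ᶠ n in atTop, press φ n < pressure φ + δ := by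
    refine eventually_lt_of_limsup_lt ?_ (isBoundedUnder_press φ)
    rw [← pressure_eq_limsup]
    linarith
  refine pressure_le_of_tendsto (u := fun n => pressure φ + δ + u n) ?_ ?_
  · have := hu.const_add (pressure φ + δ)
    rwa [add_right_comm] at this
  · filter_upwards [h, h1] with n h2 h3
    linarith

/-- The pressure is bounded by the finite volume pressures. -/
theorem pressure_le_press (ψ : C(Pt X, ℝ)) (m : ℕ) : pressure ψ ≤ press ψ m := by
  have hm : ((box d m).card : ℝ) ≠ 0 := by exact_mod_cast (card_box_pos d m).ne'
  have h0 : (0 : Lattice d) ∈ box d m := mem_box.mpr fun c => by simp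
  have h1 := tendsto_card_cls m h0
  have h2 := (h1.mul_const (Real.log (Z ψ (box d m)))).add
    (((h1.mul_const ((box d m).card : ℝ)).const_sub 1).mul_const
      (Real.log ((Nat.card A : ℝ) * Real.exp ‖ψ‖)))
  -- The tiles of one class fill Λ_n up to a vanishing fraction, so the crude bound on the uncovered
  -- sites disappears in the limit.
  rw [inv_mul_cancel₀ hm, sub_self, zero_mul, add_zero] at h2
  refine pressure_le_of_tendsto h2 (Eventually.of_forall fun n => ?_)
  have hn : (0 : ℝ) < (box d n).card := by exact_mod_cast card_box_pos d n
  rw [press, inv_mul_le_iff₀ hn]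
  refine (log_Z_le ψ n m).trans (le_of_eq ?_)
  field_simp

end Pressure

/-! ### From partition functions with extra factors to the measure of a clopen set. -/

section Tangent

variable {d : ℕ} {A : Type*} [TopologicalSpace A] {X : ShiftSpace d A}

/-- The value of `G x` is determined by the restriction of `x` to `S`. -/
def LocalOn {β : Type*} (G : Pt X → β) (S : Set (Lattice d)) : Prop :=
  ∀ x y : Pt X, Set.EqOn x.1 y.1 S → G x = G y

/-- The union of the boxes of radius `M` which are disjoint from `j + Λ_M` and do not come after it
in the order given by the sum of the coordinates. -/
def past (M : ℕ) (j : Lattice d) : Set (Lattice d) :=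
  {k | ∃ i : Lattice d, ∑ c, i c ≤ ∑ c, j c ∧ Separated M i j ∧ k ∈ tbox i M}

variable [Finite A] [DiscreteTopology A]

/-- The site with the largest coordinate sum is removed first. All other tiles then lie in its past,
so the product of the remaining factors is an admissible g in `step`. -/
theorem wsum_prod_le (φ : C(Pt X, ℝ)) {n M : ℕ} (h : Lattice d → Pt X → ℝ) (a : Lattice d → ℝ)
    (J : Finset (Lattice d)) (hJ : J ⊆ inner d n M)
    (hsep : ∀ i ∈ J, ∀ j ∈ J, i ≠ j → Separated M i j) (h0 : ∀ j, 0 ≤ h j)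
    (hloc : ∀ j, LocalOn (h j) (tbox j M : Set (Lattice d))) (ha : ∀ j, 0 ≤ a j)
    (step : ∀ j ∈ J, ∀ g : Pt X → ℝ, 0 ≤ g → LocalOn g (past M j ∩ box d n) →
      wsum φ (box d n) (g * h j) ≤ a j * wsum φ (box d n) g) :
    wsum φ (box d n) (∏ j ∈ J, h j) ≤ (∏ j ∈ J, a j) * Z φ (box d n) := by
  classical
  induction J using Finset.induction_on_max_value (fun j : Lattice d => ∑ c, j c) with
  | empty => simp [wsum_one]
  | insert b s hb hmax ih =>
    rw [Finset.prod_insert hb, Finset.prod_insert hb, mul_comm (h b), mul_assoc]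
    have hs : s ⊆ insert b s := Finset.subset_insert b s
    refine (step b (Finset.mem_insert_self b s) _ (Finset.prod_nonneg fun j _ => h0 j) ?_).trans
      (mul_le_mul_of_nonneg_left (ih (hs.trans hJ) (fun i hi j hj => hsep i (hs hi) j (hs hj))
        (fun j hj => step j (hs hj))) (ha b))
    intro x y hxy
    rw [Finset.prod_apply, Finset.prod_apply]
    refine Finset.prod_congr rfl fun j hj => hloc j x y fun k hk => hxy ⟨⟨j, hmax j hj, ?_, hk⟩, ?_⟩
    · exact hsep j (hs hj) b (Finset.mem_insert_self b s) fun e => hb (e ▸ hj)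
    · exact tbox_subset_of_mem_inner (hJ (hs hj)) hk

/-- The indicator function of a clopen set. -/
def ind {D : Set (Pt X)} (hD : IsClopen D) : C(Pt X, ℝ) where
  toFun := D.indicator 1
  continuous_toFun := continuous_one.indicator fun a ha => by simp [hD.frontier_eq] at ha

omit [Finite A] [DiscreteTopology A] in
theorem ind_apply {D : Set (Pt X)} (hD : IsClopen D) (x : Pt X) :
    ind hD x = D.indicator 1 x := rfl

omit [Finite A] [DiscreteTopology A] in
theorem abs_ind_le {D : Set (Pt X)} (hD : IsClopen D) (x : Pt X) : |ind hD x| ≤ 1 := by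
  rw [ind_apply]
  by_cases h : x ∈ D <;> simp [h]

omit [Finite A] [DiscreteTopology A] in
theorem localOn_ind_T {D : Set (Pt X)} (hD : IsClopen D) {M : ℕ}
    (hloc : LocalOn (· ∈ D) (box d M : Set (Lattice d))) (j : Lattice d) :
    LocalOn (fun x => ind hD (T j x)) (tbox j M : Set (Lattice d)) := by
  intro x y hxy
  have h1 := hloc _ _ (eqOn_T_box_iff.mpr hxy)
  simp only [eq_iff_iff] at h1
  simp only [ind_apply]
  by_cases h : T j x ∈ D
  · rw [Set.indicator_of_mem h, Set.indicator_of_mem (h1.mp h)]; rfl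
  · rw [Set.indicator_of_notMem h, Set.indicator_of_notMem (fun h' => h (h1.mpr h'))]

omit [Finite A] [DiscreteTopology A] in
-- Jensen's inequality: the sum over inner sites, divided by |Λ_M|, is the mean over the |Λ_M|
-- residue classes of the class sums. Sites outside `inner d n M` contribute at most 1/|Λ_M| each.
theorem exp_birk_ind_le {D : Set (Pt X)} (hD : IsClopen D) {s : ℝ} (hs : |s| ≤ 1) (n M : ℕ)
    (x : Pt X) :
    Real.exp (birk ((s / (box d M).card) • ind hD) (box d n) x) ≤
      Real.exp (((box d n).card - (inner d n M).card) / (box d M).card) *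
        ∑ r ∈ box d M, ((box d M).card : ℝ)⁻¹ *
          ∏ j ∈ cls n M r, Real.exp (s * ind hD (T j x)) := by
  have hK : (0 : ℝ) < (box d M).card := by exact_mod_cast card_box_pos d M
  have hsub : inner d n M ⊆ box d n := Finset.filter_subset _ _
  have h1 : birk ((s / (box d M).card) • ind hD) (box d n) x ≤
      ((box d n).card - (inner d n M).card) / (box d M).card +
        ∑ r ∈ box d M, ((box d M).card : ℝ)⁻¹ * ∑ j ∈ cls n M r, s * ind hD (T j x) := by
    rw [← Finset.mul_sum, sum_cls]
    have h2 : ∑ j ∈ box d n \ inner d n M, s * ind hD (T j x) ≤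
        (box d n).card - (inner d n M).card := by
      refine (Finset.sum_le_card_nsmul _ _ 1 fun j _ => ?_).trans (le_of_eq ?_)
      · refine (le_abs_self _).trans ?_
        rw [abs_mul]
        exact mul_le_one₀ hs (abs_nonneg _) (abs_ind_le hD _)
      · rw [nsmul_one, Finset.cast_card_sdiff hsub]
    have h3 : birk ((s / (box d M).card) • ind hD) (box d n) x =
        ((box d M).card : ℝ)⁻¹ * ∑ j ∈ box d n, s * ind hD (T j x) := by
      simp only [birk, ContinuousMap.coe_smul, Pi.smul_apply, smul_eq_mul, Finset.mul_sum]
      exact Finset.sum_congr rfl fun j _ => by ring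
    rw [h3, ← Finset.sum_sdiff hsub, mul_add, inv_mul_eq_div, inv_mul_eq_div]
    gcongr
  refine (Real.exp_le_exp.mpr h1).trans ?_
  rw [Real.exp_add]
  refine mul_le_mul_of_nonneg_left ?_ (Real.exp_pos _).le
  have h4 := convexOn_exp.map_sum_le (t := box d M) (w := fun _ => ((box d M).card : ℝ)⁻¹)
    (p := fun r => ∑ j ∈ cls n M r, s * ind hD (T j x)) (fun _ _ => by positivity)
    (by simp [hK.ne']) (fun _ _ => Set.mem_univ _)
  simpa only [smul_eq_mul, Real.exp_sum] using h4

/-- The representatives for φ + f and for φ may differ. Since H depends only on the pattern on V, it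
can be evaluated at either one. -/
theorem Z_add_le_wsum (φ f : C(Pt X, ℝ)) (V : Finset (Lattice d)) {H : Pt X → ℝ} (hH : 0 ≤ H)
    (hloc : LocalOn H (V : Set (Lattice d))) (h : ∀ x, Real.exp (birk f V x) ≤ H x) :
    Z (φ + f) V ≤ wsum φ V H := by
  refine sum_le_sum_of_injOn (rep φ V) (fun r _ => rep_mem _ _ _) ?_ ?_ ?_
  · intro r hr r' hr' e
    exact reps_inj hr hr' (eqOn_of_rep_eq e)
  · intro r _
    rw [birk_add, Real.exp_add, hloc _ _ (rep_eqOn φ V r)]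
    exact mul_le_mul (Real.exp_le_exp.mpr (birk_le_rep φ V r)) (h r) (Real.exp_pos _).le
      (Real.exp_pos _).le
  · intro r _
    exact mul_nonneg (Real.exp_pos _).le (hH r)

theorem wsum_smul_sum (φ : C(Pt X, ℝ)) (V : Finset (Lattice d)) {ι : Type*} (I : Finset ι)
    (c e : ℝ) (G : ι → Pt X → ℝ) :
    wsum φ V (fun x => c * ∑ i ∈ I, e * G i x) = c * ∑ i ∈ I, e * wsum φ V (G i) := by
  simp only [wsum, Finset.mul_sum]
  rw [Finset.sum_comm]
  exact Finset.sum_congr rfl fun i _ => Finset.sum_congr rfl fun r _ => by ring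

theorem press_add_ind_le [Nonempty (Pt X)] (φ : C(Pt X, ℝ)) (n : ℕ) {M : ℕ} {D : Set (Pt X)}
    (hD : IsClopen D)
    (hloc : LocalOn (· ∈ D) (box d M : Set (Lattice d))) {s θ : ℝ} (hs : |s| ≤ 1)
    (step : ∀ j ∈ inner d n M, ∀ g : Pt X → ℝ, 0 ≤ g → LocalOn g (past M j ∩ box d n) →
      wsum φ (box d n) (fun x => g x * Real.exp (s * ind hD (T j x))) ≤
        Real.exp θ * wsum φ (box d n) g) :
    press (φ + (s / (box d M).card) • ind hD) n ≤ press φ n +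
      ((((box d n).card - (inner d n M).card) / (box d n).card) * ((box d M).card : ℝ)⁻¹ +
        (((box d n).card - (inner d n M).card) / (box d n).card) * |θ| +
          θ / (box d M).card) := by
  have hK : (0 : ℝ) < (box d M).card := by exact_mod_cast card_box_pos d M
  have hn : (0 : ℝ) < (box d n).card := by exact_mod_cast card_box_pos d n
  set bd : ℝ := (box d n).card - (inner d n M).card with hbd
  have hbd0 : 0 ≤ bd := by
    rw [hbd, sub_nonneg]; exact_mod_cast Finset.card_filter_le _ _
  have h1 : Z (φ + (s / (box d M).card) • ind hD) (box d n) ≤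
      Real.exp (bd / (box d M).card) * ∑ r ∈ box d M, ((box d M).card : ℝ)⁻¹ *
        wsum φ (box d n) (∏ j ∈ cls n M r, fun x => Real.exp (s * ind hD (T j x))) := by
    rw [← wsum_smul_sum]
    refine Z_add_le_wsum φ _ (box d n) (fun x => ?_) ?_ (fun x => ?_)
    · rw [Pi.zero_apply]
      refine mul_nonneg (Real.exp_pos _).le (Finset.sum_nonneg fun r _ => ?_)
      rw [Finset.prod_apply]
      exact mul_nonneg (inv_nonneg.mpr hK.le) (Finset.prod_nonneg fun j _ => (Real.exp_pos _).le)
    · intro x y hxy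
      simp only [Finset.prod_apply]
      congr 1
      refine Finset.sum_congr rfl fun r _ => ?_
      congr 1
      refine Finset.prod_congr rfl fun j hj => ?_
      exact congrArg (fun t => Real.exp (s * t)) (localOn_ind_T hD hloc j x y (hxy.mono
        (tbox_subset_of_mem_inner (cls_subset_inner n M r hj))))
    · simp only [Finset.prod_apply]
      exact exp_birk_ind_le hD hs n M x
  have h2 : ∀ r ∈ box d M,
      wsum φ (box d n) (∏ j ∈ cls n M r, fun x => Real.exp (s * ind hD (T j x))) ≤
        Real.exp (θ * ((box d n).card / (box d M).card) + |θ| * bd) * Z φ (box d n) := by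
    intro r hr
    have h3 := wsum_prod_le φ (fun j x => Real.exp (s * ind hD (T j x))) (fun _ => Real.exp θ)
      (cls n M r) (cls_subset_inner n M r)
      (fun i hi j hj hne => separated_of_mem_cls hi hj hne) (fun j x => (Real.exp_pos _).le)
      (fun j x y hxy => congrArg (fun t => Real.exp (s * t)) (localOn_ind_T hD hloc j x y hxy))
      (fun _ => (Real.exp_pos _).le) (fun j hj => step j (cls_subset_inner n M r hj))
    refine h3.trans ?_
    rw [Finset.prod_const, ← Real.exp_nat_mul]
    refine mul_le_mul_of_nonneg_right (Real.exp_le_exp.mpr ?_) (Z_nonneg _ _)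
    have h4 : ((cls n M r).card : ℝ) ≤ (box d n).card / (box d M).card := by
      rw [le_div_iff₀ hK]; exact_mod_cast card_cls_mul_le n M r
    have h5 : (box d n).card / (box d M).card - bd ≤ ((cls n M r).card : ℝ) := by
      refine le_of_mul_le_mul_right (le_trans (le_of_eq ?_) (le_card_cls_mul n M hr)) hK
      field_simp
      ring
    -- The sign of θ is not known: θ ≥ 0 needs the upper bound on the number of tiles, θ < 0 the
    -- lower one.
    rcases abs_cases θ with ⟨e, h6⟩ | ⟨e, h6⟩ <;> rw [e] <;> nlinarith
  have h7 : Z (φ + (s / (box d M).card) • ind hD) (box d n) ≤ Real.exp (bd / (box d M).card +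
      (θ * ((box d n).card / (box d M).card) + |θ| * bd)) * Z φ (box d n) := by
    refine h1.trans ?_
    rw [Real.exp_add, mul_assoc]
    refine mul_le_mul_of_nonneg_left ?_ (Real.exp_pos _).le
    refine (Finset.sum_le_sum fun r hr =>
      mul_le_mul_of_nonneg_left (h2 r hr) (inv_nonneg.mpr hK.le)).trans (le_of_eq ?_)
    rw [Finset.sum_const, nsmul_eq_mul, mul_inv_cancel_left₀ hK.ne']
  rw [press, inv_mul_le_iff₀ hn]
  refine (Real.log_le_log (Z_pos _ _) h7).trans (le_of_eq ?_)
  rw [Real.log_mul (Real.exp_pos _).ne' (Z_pos _ _).ne', Real.log_exp, press]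
  field_simp
  ring

/-- A bound for the effect of a clopen set `D` on the finite volume partition functions gives a
bound for the measure of `D` with respect to a tangent functional. -/
theorem IsTangentFunctional.mul_measure_le [MeasurableSpace A] [BorelSpace A]
    {φ : C(Pt X, ℝ)} {ν : Measure (Pt X)} (hν : IsTangentFunctional ν φ) {M : ℕ} {D : Set (Pt X)}
    (hD : IsClopen D) (hloc : LocalOn (· ∈ D) (box d M : Set (Lattice d))) {s θ : ℝ} (hs : |s| ≤ 1)
    (step : ∀ n, ∀ j ∈ inner d n M, ∀ g : Pt X → ℝ, 0 ≤ g → LocalOn g (past M j ∩ box d n) →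
      wsum φ (box d n) (fun x => g x * Real.exp (s * ind hD (T j x))) ≤
        Real.exp θ * wsum φ (box d n) g) :
    s * ν.real D ≤ θ := by
  have := hν.isProbabilityMeasure
  have : Nonempty (Pt X) := nonempty_of_isProbabilityMeasure ν
  have hK : (0 : ℝ) < (box d M).card := by exact_mod_cast card_box_pos d M
  have h1 : Tendsto (fun n => (((box d n).card - (inner d n M).card : ℝ) / (box d n).card) *
      ((box d M).card : ℝ)⁻¹ + (((box d n).card - (inner d n M).card : ℝ) / (box d n).card) * |θ| +
          θ / (box d M).card) atTop (𝓝 (θ / (box d M).card)) := by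
    have h2 := tendsto_boundary d M
    have h3 := ((h2.mul_const ((box d M).card : ℝ)⁻¹).add (h2.mul_const |θ|)).add_const
      (θ / (box d M).card)
    simpa using h3
  -- There is one tile per |Λ_M| sites, so a cost θ per tile raises the pressure by at most θ/|Λ_M|.
  -- The integral of the test function carries the same factor 1/|Λ_M|, which cancels.
  have h4 := pressure_le_add_of_tendsto h1 (Eventually.of_forall fun n =>
    press_add_ind_le φ n hD hloc hs (step n))
  have h5 := (hν.tangent _).trans h4
  have h6 : ∫ x, ((s / (box d M).card) • ind hD) x ∂ν = s / (box d M).card * ν.real D := by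
    simp only [ContinuousMap.coe_smul, Pi.smul_apply, smul_eq_mul, ind_apply]
    rw [integral_const_mul, integral_indicator_one hD.1.measurableSet]
  rw [h6, add_le_add_iff_left, div_mul_eq_mul_div, div_le_div_iff_of_pos_right hK] at h5
  exact h5

end Tangent

/-! ### Surgery on configurations and the resulting bounds on cylinder measures. -/

section Replacement

universe u

variable {d : ℕ} {A : Type u} [TopologicalSpace A] {X : ShiftSpace d A}

/-- The pattern of any point on `Λ_m`, translated by at most `M - m`, can be inserted near `j` into
any configuration, such that the past of `j` is not affected. Up to the error `η` on a logarithmic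
scale, the energies add up and the data before the insertion can be recovered from the result. -/
def Replaceable (φ : C(Pt X, ℝ)) (m M : ℕ) (η : ℝ) : Prop :=
  ∀ n, ∀ j ∈ inner d n M, ∃ (κ : Type u) (_ : Fintype κ) (E : ℝ) (z : Pt X → Pt X → Pt X)
    (code : Pt X → Pt X → κ),
    (Fintype.card κ : ℝ) * Real.exp E ≤ Real.exp η ∧
    (∀ x y, Set.EqOn (z x y).1 x.1 (past M j ∩ box d n)) ∧
    (∀ x y, ∃ l ∈ box d (M - m), Set.EqOn (T (l + j) (z x y)).1 y.1 (box d m : Set (Lattice d))) ∧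
    (∀ x y, birk φ (box d n) x + birk φ (box d m) y ≤
      birk φ (box d n) (z x y) + birk φ (box d m) (T j x) + E) ∧
    ∀ x y x' y', Set.EqOn (z x y).1 (z x' y').1 (box d n : Set (Lattice d)) →
      code x y = code x' y' →
        Set.EqOn x.1 x'.1 ((box d n : Set (Lattice d)) \ tbox j m) ∧
        Set.EqOn y.1 y'.1 (box d m : Set (Lattice d))

theorem localOn_B (m : ℕ) (x : Pt X) : LocalOn (· ∈ B m x) (box d m : Set (Lattice d)) :=
  fun _ _ h => propext ⟨fun h' => h.symm.trans h', fun h' => h.trans h'⟩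

/-- The points which agree with `x` on `Λ_m` up to a translation in `Λ_q`. -/
def shiftedB (m q : ℕ) (x : Pt X) : Set (Pt X) := ⋃ l ∈ box d q, T l ⁻¹' B m x

theorem localOn_shiftedB {m q M : ℕ} (h : m + q ≤ M) (x : Pt X) :
    LocalOn (· ∈ shiftedB m q x) (box d M : Set (Lattice d)) := by
  have key : ∀ y z : Pt X, Set.EqOn y.1 z.1 (box d M : Set (Lattice d)) →
      y ∈ shiftedB m q x → z ∈ shiftedB m q x := by
    intro y z hyz hy
    simp only [shiftedB, Set.mem_iUnion, Set.mem_preimage] at hy ⊢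
    obtain ⟨l, hl, hy⟩ := hy
    refine ⟨l, hl, (localOn_B m x _ _ (eqOn_T_box_iff.mpr (hyz.mono fun k hk => ?_))).mp hy⟩
    have h1 := mem_tbox.mp hk
    rw [mem_box] at hl
    refine mem_box.mpr fun c => ?_
    have h2 := h1 c
    have h3 := hl c
    rw [abs_le] at h2 h3 ⊢
    omega
  exact fun y z h => propext ⟨key y z h, key z y h.symm⟩

variable [Finite A] [DiscreteTopology A]

omit [Finite A] in
theorem isClopen_B (m : ℕ) (x : Pt X) : IsClopen (B m x) :=
  ⟨isClosed_eqOn _ x, isOpen_eqOn _ x⟩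

omit [Finite A] in
theorem isClopen_shiftedB (m q : ℕ) (x : Pt X) : IsClopen (shiftedB m q x) :=
  isClopen_biUnion_finset fun l _ => (isClopen_B m x).preimage (continuous_T l)

/-- Every pattern v on Λ_m is inserted into every r that shows the pattern of x at j. What gets
overwritten is known, so the result and the code determine (r, v); summing over v gives the factor
`Z φ (box d m)`. The value of g is unaffected because g sees only the past. -/
theorem Replaceable.wsum_mul_ind_le {φ : C(Pt X, ℝ)} {m M : ℕ} {η : ℝ} (h : Replaceable φ m M η)
    (x : Pt X) {n : ℕ} {j : Lattice d} (hj : j ∈ inner d n M) {g : Pt X → ℝ} (hg : 0 ≤ g)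
    (hloc : LocalOn g (past M j ∩ box d n)) :
    wsum φ (box d n) (fun y => g y * ind (isClopen_B m x) (T j y)) * Z φ (box d m) ≤
      Real.exp (η + birk φ (box d m) (rep φ (box d m) x)) * wsum φ (box d n) g := by
  classical
  obtain ⟨κ, _, E, z, code, hE, hpast, -, hen, hrec⟩ := h n j hj
  have hg' : ∀ r v, g (rep φ (box d n) (z r v)) = g r := fun r v =>
    hloc _ _ (((rep_eqOn φ (box d n) (z r v)).mono Set.inter_subset_right).trans (hpast r v))
  have h1 : wsum φ (box d n) (fun y => g y * ind (isClopen_B m x) (T j y)) =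
      ∑ r ∈ (reps φ (box d n)).filter (fun r => T j r ∈ B m x),
        Real.exp (birk φ (box d n) r) * g r := by
    rw [Finset.sum_filter]
    refine Finset.sum_congr rfl fun r _ => ?_
    by_cases hr : T j r ∈ B m x <;> simp [ind_apply, hr]
  set W := birk φ (box d m) (rep φ (box d m) x)
  have h2 : (∑ r ∈ (reps φ (box d n)).filter (fun r => T j r ∈ B m x),
      Real.exp (birk φ (box d n) r) * g r) * Z φ (box d m) ≤
        ∑ p ∈ reps φ (box d n) ×ˢ (Finset.univ : Finset κ),
          Real.exp (E + W) * (Real.exp (birk φ (box d n) p.1) * g p.1) := by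
    rw [Z, Finset.sum_mul_sum, ← Finset.sum_product']
    refine sum_le_sum_of_injOn (fun p => (rep φ (box d n) (z p.1 p.2), code p.1 p.2)) ?_ ?_ ?_ ?_
    · intro p _
      exact Finset.mem_product.mpr ⟨rep_mem _ _ _, Finset.mem_univ _⟩
    · rintro ⟨r, v⟩ hp ⟨r', v'⟩ hp' e
      obtain ⟨hr, hv⟩ := Finset.mem_product.mp hp
      obtain ⟨hr', hv'⟩ := Finset.mem_product.mp hp'
      obtain ⟨hr, hrx⟩ := Finset.mem_filter.mp hr
      obtain ⟨hr', hrx'⟩ := Finset.mem_filter.mp hr'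
      obtain ⟨e1, e2⟩ := hrec r v r' v' (eqOn_of_rep_eq (Prod.ext_iff.mp e).1) (Prod.ext_iff.mp e).2
      have e3 : Set.EqOn r.1 r'.1 (tbox j m : Set (Lattice d)) :=
        eqOn_T_box_iff.mp (hrx.trans hrx'.symm)
      refine Prod.ext (reps_inj hr hr' fun k hk => ?_) (reps_inj hv hv' e2)
      by_cases hkj : k ∈ tbox j m
      · exact e3 hkj
      · exact e1 ⟨hk, hkj⟩
    · rintro ⟨r, v⟩ hp
      obtain ⟨hr, hv⟩ := Finset.mem_product.mp hp
      obtain ⟨hr, hrx⟩ := Finset.mem_filter.mp hr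
      simp only [hg']
      rw [mul_right_comm, ← mul_assoc, ← Real.exp_add, ← Real.exp_add]
      refine mul_le_mul_of_nonneg_right (Real.exp_le_exp.mpr ?_) (hg r)
      have h3 := hen r v
      have h4 := birk_le_rep φ (box d n) (z r v)
      have h5 := birk_le_rep φ (box d m) (T j r)
      rw [rep_eq_of_eqOn hrx] at h5
      linarith
    · intro p _
      exact mul_nonneg (Real.exp_pos _).le (mul_nonneg (Real.exp_pos _).le (hg _))
  rw [h1]
  refine h2.trans ?_
  rw [Finset.sum_product, Real.exp_add η W]
  simp only [Finset.sum_const, Finset.card_univ, nsmul_eq_mul]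
  rw [← Finset.mul_sum, ← Finset.mul_sum, Real.exp_add, ← mul_assoc, ← mul_assoc]
  exact mul_le_mul_of_nonneg_right (mul_le_mul_of_nonneg_right hE (Real.exp_pos _).le)
    (wsum_nonneg φ _ hg)

/-- The pattern of x is inserted into every r. The overwritten pattern is now unknown and has to be
recorded, which costs `Z φ (box d m)`. The insertion is exact only up to a translation, hence
`shiftedB`. -/
theorem Replaceable.wsum_le {φ : C(Pt X, ℝ)} {m M : ℕ} {η : ℝ} (h : Replaceable φ m M η)
    (x : Pt X) {n : ℕ} {j : Lattice d} (hj : j ∈ inner d n M) {g : Pt X → ℝ} (hg : 0 ≤ g)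
    (hloc : LocalOn g (past M j ∩ box d n)) (hmM : m ≤ M) :
    wsum φ (box d n) g ≤ Real.exp (η - birk φ (box d m) x) * Z φ (box d m) *
      wsum φ (box d n) (fun y => g y * ind (isClopen_shiftedB m (M - m) x) (T j y)) := by
  classical
  obtain ⟨κ, _, E, z, code, hE, hpast, hins, hen, hrec⟩ := h n j hj
  have hg' : ∀ r, g (rep φ (box d n) (z r x)) = g r := fun r =>
    hloc _ _ (((rep_eqOn φ (box d n) (z r x)).mono Set.inter_subset_right).trans (hpast r x))
  have hind : ∀ r, ind (isClopen_shiftedB m (M - m) x) (T j (rep φ (box d n) (z r x))) = 1 := by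
    intro r
    refine (localOn_ind_T (isClopen_shiftedB m (M - m) x) (M := M) (localOn_shiftedB (by omega) x) j
      _ (z r x) ((rep_eqOn φ (box d n) (z r x)).mono (tbox_subset_of_mem_inner hj))).trans ?_
    simp only
    rw [ind_apply, Set.indicator_of_mem, Pi.one_apply]
    obtain ⟨l, hl, hz⟩ := hins r x
    simp only [shiftedB, Set.mem_iUnion, Set.mem_preimage]
    exact ⟨l, hl, by rw [T_T]; exact hz⟩
  have hnn : ∀ y, 0 ≤ g y * ind (isClopen_shiftedB m (M - m) x) (T j y) := fun y =>
    mul_nonneg (hg y) (by rw [ind_apply]; exact Set.indicator_nonneg (fun _ _ => zero_le_one) _)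
  have h2 : wsum φ (box d n) g ≤
      ∑ p ∈ reps φ (box d n) ×ˢ (reps φ (box d m) ×ˢ (Finset.univ : Finset κ)),
        (Real.exp (E - birk φ (box d m) x) * Real.exp (birk φ (box d m) p.2.1)) *
          (Real.exp (birk φ (box d n) p.1) *
            (g p.1 * ind (isClopen_shiftedB m (M - m) x) (T j p.1))) := by
    refine sum_le_sum_of_injOn
      (fun r => (rep φ (box d n) (z r x), rep φ (box d m) (T j r), code r x)) ?_ ?_ ?_ ?_
    · intro p _
      exact Finset.mem_product.mpr ⟨rep_mem _ _ _, Finset.mem_product.mpr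
        ⟨rep_mem _ _ _, Finset.mem_univ _⟩⟩
    · intro r hr r' hr' e
      simp only [Prod.mk.injEq] at e
      obtain ⟨e1, -⟩ := hrec r x r' x (eqOn_of_rep_eq e.1) e.2.2
      have e3 : Set.EqOn r.1 r'.1 (tbox j m : Set (Lattice d)) :=
        eqOn_T_box_iff.mp (eqOn_of_rep_eq e.2.1)
      refine reps_inj hr hr' fun k hk => ?_
      by_cases hkj : k ∈ tbox j m
      · exact e3 hkj
      · exact e1 ⟨hk, hkj⟩
    · intro r hr
      simp only [hg', hind, mul_one]
      rw [← mul_assoc, ← Real.exp_add, ← Real.exp_add]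
      refine mul_le_mul_of_nonneg_right (Real.exp_le_exp.mpr ?_) (hg r)
      have h3 := hen r x
      have h4 := birk_le_rep φ (box d n) (z r x)
      have h5 := birk_le_rep φ (box d m) (T j r)
      linarith
    · intro p _
      exact mul_nonneg (by positivity) (mul_nonneg (Real.exp_pos _).le (hnn _))
  refine h2.trans ?_
  rw [Finset.sum_product]
  simp_rw [← Finset.sum_mul]
  rw [← Finset.mul_sum]
  refine mul_le_mul_of_nonneg_right ?_ (wsum_nonneg φ _ hnn)
  rw [Finset.sum_product]
  simp only [Finset.sum_const, Finset.card_univ, nsmul_eq_mul]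
  rw [← Finset.mul_sum, ← Finset.mul_sum, sub_eq_add_neg, sub_eq_add_neg, Real.exp_add,
    Real.exp_add, ← mul_assoc, ← mul_assoc]
  exact mul_le_mul_of_nonneg_right (mul_le_mul_of_nonneg_right hE (Real.exp_pos _).le)
    (Z_nonneg φ _)

theorem le_of_forall_small {a b c : ℝ} (h : ∀ s : ℝ, 0 < s → s ≤ 1 → a ≤ b + s * c) : a ≤ b := by
  have h1 : Tendsto (fun s : ℝ => b + s * c) (𝓝[>] 0) (𝓝 (b + 0 * c)) :=
    ((continuous_const.add (continuous_id.mul continuous_const)).tendsto 0).mono_left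
      nhdsWithin_le_nhds
  rw [zero_mul, add_zero] at h1
  refine ge_of_tendsto h1 ?_
  filter_upwards [Ioc_mem_nhdsGT (zero_lt_one' ℝ)] with s hs using h s hs.1 hs.2

section Bounds

variable {φ : C(Pt X, ℝ)} {m M : ℕ} {η v : ℝ}

/-- The weight of one point x in Λ_n is at most the weight of all patterns that agree with x on the
tiles of one class, and each of these constraints contributes a factor `a j`. The energies of x on
the tiles cancel from both sides, leaving Z_n ≥ Z_m^(number of tiles) up to errors. -/
theorem Replaceable.log_Z_le [Nonempty (Pt X)] (h : Replaceable φ m M η) (hmM : m ≤ M)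
    (hv : ∀ x y : Pt X, Set.EqOn x.1 y.1 (box d m : Set (Lattice d)) →
      birk φ (box d m) x ≤ birk φ (box d m) y + v) :
    Real.log (Z φ (box d m)) ≤ (box d M).card * pressure φ + η + v +
      ‖φ‖ * ((box d M).card - (box d m).card) := by
  have hM : (0 : ℝ) < (box d M).card := by exact_mod_cast card_box_pos d M
  have h0 : (0 : Lattice d) ∈ box d M := mem_box.mpr fun c => by simp
  obtain ⟨x⟩ := ‹Nonempty (Pt X)›
  have : Nonempty (Pt X) := ⟨x⟩
  have hZm := Z_pos φ (box d m)
  have key : ∀ n, (cls n M (0 : Lattice d)).card * (Real.log (Z φ (box d m)) - η - v) -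
      ‖φ‖ * ((box d n).card - (cls n M (0 : Lattice d)).card * (box d m).card) ≤
        Real.log (Z φ (box d n)) := by
    intro n
    set J := cls n M (0 : Lattice d) with hJ
    set a : Lattice d → ℝ := fun j =>
      Real.exp (η + birk φ (box d m) (rep φ (box d m) (T j x))) / Z φ (box d m) with ha
    have h1 := wsum_prod_le φ (fun j y => ind (isClopen_B m (T j x)) (T j y)) a J
      (cls_subset_inner n M 0) (fun i hi j hj hne => separated_of_mem_cls hi hj hne)
      (fun j y => by
        simp only [Pi.zero_apply, ind_apply]
        exact Set.indicator_nonneg (fun _ _ => zero_le_one) _)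
      (fun j y z hyz => localOn_ind_T (isClopen_B m (T j x)) (localOn_B m (T j x)) j y z
        (hyz.mono (tbox_mono j hmM))) (fun j => by positivity)
      (fun j hj g hg hloc => by
        rw [ha]
        simp only
        rw [div_mul_eq_mul_div, le_div_iff₀ hZm]
        exact h.wsum_mul_ind_le (T j x) (cls_subset_inner n M 0 hj) hg hloc)
    have h2 : Real.exp (birk φ (box d n) x) ≤
        wsum φ (box d n) (∏ j ∈ J, fun y => ind (isClopen_B m (T j x)) (T j y)) := by
      refine le_trans ?_ (Finset.single_le_sum (f := fun r => Real.exp (birk φ (box d n) r) *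
        (∏ j ∈ J, fun y => ind (isClopen_B m (T j x)) (T j y)) r) (fun r _ => ?_)
        (rep_mem φ (box d n) x))
      · rw [Finset.prod_apply, Finset.prod_eq_one, mul_one]
        · exact Real.exp_le_exp.mpr (birk_le_rep _ _ _)
        · intro j hj
          rw [ind_apply, Set.indicator_of_mem, Pi.one_apply]
          exact eqOn_T_box_iff.mpr ((rep_eqOn φ (box d n) x).mono
            ((tbox_mono j hmM).trans (tbox_subset_of_mem_inner (cls_subset_inner n M 0 hj))))
      · rw [Finset.prod_apply]
        refine mul_nonneg (Real.exp_pos _).le (Finset.prod_nonneg fun j _ => ?_)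
        rw [ind_apply]
        exact Set.indicator_nonneg (fun _ _ => zero_le_one) _
    have h3 := Real.log_le_log (Real.exp_pos _) (h2.trans h1)
    rw [Real.log_exp, Real.log_mul (Finset.prod_ne_zero_iff.mpr fun j _ => by positivity)
      (Z_pos _ _).ne', Real.log_prod (fun j _ => by positivity)] at h3
    have h4 : ∑ j ∈ J, Real.log (a j) ≤ ∑ j ∈ J, birk φ (tbox j m) x -
        J.card * (Real.log (Z φ (box d m)) - η - v) := by
      rw [← nsmul_eq_mul, ← Finset.sum_const, ← Finset.sum_sub_distrib]
      refine Finset.sum_le_sum fun j _ => ?_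
      rw [ha]
      simp only
      rw [Real.log_div (Real.exp_pos _).ne' hZm.ne', Real.log_exp, birk_tbox]
      have := hv _ _ (rep_eqOn φ (box d m) (T j x))
      linarith
    have h5 : ∑ j ∈ J, birk φ (tbox j m) x = birk φ (J.biUnion fun j => tbox j m) x := by
      rw [birk, Finset.sum_biUnion]
      · rfl
      · intro i hi j hj hne
        exact ((separated_of_mem_cls hi hj hne).disjoint).mono (tbox_mono i hmM) (tbox_mono j hmM)
    have h6 := (abs_le.mp (birk_le_add_of_subset φ (biUnion_tbox_subset (n := n) hmM 0) x)).1
    rw [card_biUnion_tbox hmM] at h6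
    push_cast at h6
    rw [h5] at h4
    linarith
  have h1 := tendsto_card_cls M h0
  have h2 := (h1.mul_const (Real.log (Z φ (box d m)) - η - v)).sub
    (((h1.mul_const ((box d m).card : ℝ)).const_sub 1).const_mul ‖φ‖)
  have h3 := le_pressure_of_tendsto h2 (Eventually.of_forall fun n => by
    have hn : (0 : ℝ) < (box d n).card := by exact_mod_cast card_box_pos d n
    change _ ≤ ((box d n).card : ℝ)⁻¹ * Real.log (Z φ (box d n))
    rw [le_inv_mul_iff₀ hn]
    refine le_trans (le_of_eq ?_) (key n)
    field_simp)
  have h4 := mul_le_mul_of_nonneg_left h3 hM.le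
  have h5 : ((box d M).card : ℝ) * (((box d M).card : ℝ)⁻¹ * (Real.log (Z φ (box d m)) - η - v) -
      ‖φ‖ * (1 - ((box d M).card : ℝ)⁻¹ * (box d m).card)) =
      (Real.log (Z φ (box d m)) - η - v) - ‖φ‖ * ((box d M).card - (box d m).card) := by
    field_simp
  linarith

variable [MeasurableSpace A] [BorelSpace A] {ν : Measure (Pt X)}

/-- For an indicator, exp(s·1_B) = 1 + (e^s − 1)·1_B. If B carries at most the share ε of the
weight, removing this factor costs at most 1 + (e^s − 1)ε ≤ e^θ with θ = (e^s − 1)ε. Then divide by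
s and let s → 0, using e^s − 1 ≤ s + s². -/
theorem Replaceable.measure_B_le (h : Replaceable φ m M η) (hmM : m ≤ M)
    (hν : IsTangentFunctional ν φ) (x : Pt X) :
    ν.real (B m x) ≤ Real.exp (η + birk φ (box d m) (rep φ (box d m) x)) / Z φ (box d m) := by
  have : Nonempty (Pt X) := ⟨x⟩
  have hZm := Z_pos φ (box d m)
  set ε := Real.exp (η + birk φ (box d m) (rep φ (box d m) x)) / Z φ (box d m) with hε
  have hε0 : 0 < ε := by positivity
  refine le_of_forall_small (c := ε) fun s hs0 hs1 => ?_
  have he : (1 : ℝ) ≤ Real.exp s := Real.one_le_exp hs0.le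
  have key : s * ν.real (B m x) ≤ (Real.exp s - 1) * ε := by
    refine hν.mul_measure_le (isClopen_B m x) (M := M)
      (fun y z hyz => localOn_B m x y z (hyz.mono (box_mono hmM)))
      (abs_le.mpr ⟨by linarith, hs1⟩) ?_
    intro n j hj g hg hloc
    have h1 := h.wsum_mul_ind_le x hj hg hloc
    rw [← le_div_iff₀ hZm, mul_div_right_comm, ← hε] at h1
    have h2 : wsum φ (box d n) (fun y => g y * Real.exp (s * ind (isClopen_B m x) (T j y))) =
        wsum φ (box d n) g + (Real.exp s - 1) *
          wsum φ (box d n) (fun y => g y * ind (isClopen_B m x) (T j y)) := by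
      simp only [wsum]
      rw [Finset.mul_sum, ← Finset.sum_add_distrib]
      refine Finset.sum_congr rfl fun r _ => ?_
      rw [ind_apply]
      by_cases hr : T j r ∈ B m x <;> simp [hr]
      ring
    rw [h2]
    have h3 := Real.add_one_le_exp ((Real.exp s - 1) * ε)
    have h4 := wsum_nonneg φ (box d n) hg
    nlinarith [mul_le_mul_of_nonneg_left h1 (sub_nonneg.mpr he), mul_le_mul_of_nonneg_right h3 h4]
  have h5 := (abs_le.mp (Real.abs_exp_sub_one_sub_id_le (x := s)
    (abs_le.mpr ⟨by linarith, hs1⟩))).2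
  have h6 : s * ν.real (B m x) ≤ s * (ε + s * ε) := by nlinarith
  exact le_of_mul_le_mul_left h6 hs0

/-- The same argument with −s in place of s: a share of at least ε lowers the sum by the factor 1 −
(1 − e^(−s))ε, so θ is negative and the inequality for ν reverses. -/
theorem Replaceable.le_measure_shiftedB (h : Replaceable φ m M η) (hmM : m ≤ M)
    (hν : IsTangentFunctional ν φ) (x : Pt X) :
    Real.exp (birk φ (box d m) x - η) / Z φ (box d m) ≤ ν.real (shiftedB m (M - m) x) := by
  have : Nonempty (Pt X) := ⟨x⟩
  have hZm := Z_pos φ (box d m)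
  set ε := Real.exp (birk φ (box d m) x - η) / Z φ (box d m) with hε
  have hε0 : 0 < ε := by positivity
  refine le_of_forall_small (c := ε) fun s hs0 hs1 => ?_
  have he : Real.exp (-s) ≤ 1 := Real.exp_le_one_iff.mpr (by linarith)
  have key : (-s) * ν.real (shiftedB m (M - m) x) ≤ -((1 - Real.exp (-s)) * ε) := by
    refine hν.mul_measure_le (isClopen_shiftedB m (M - m) x) (M := M)
      (localOn_shiftedB (by omega) x) (abs_le.mpr ⟨by linarith, by linarith⟩) ?_
    intro n j hj g hg hloc
    have h1 := h.wsum_le x hj hg hloc hmM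
    set w := wsum φ (box d n) (fun y => g y * ind (isClopen_shiftedB m (M - m) x) (T j y)) with hw
    have h0 : ε * wsum φ (box d n) g ≤ w := by
      rw [hε, div_mul_eq_mul_div, div_le_iff₀ hZm]
      have h2 := mul_le_mul_of_nonneg_left h1 (Real.exp_pos (birk φ (box d m) x - η)).le
      refine h2.trans (le_of_eq ?_)
      rw [← mul_assoc, ← mul_assoc, ← Real.exp_add]
      simp only [sub_add_sub_cancel, sub_self, Real.exp_zero, one_mul]
      ring
    have h2 : wsum φ (box d n)
        (fun y => g y * Real.exp (-s * ind (isClopen_shiftedB m (M - m) x) (T j y))) =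
        wsum φ (box d n) g - (1 - Real.exp (-s)) * w := by
      rw [hw]
      simp only [wsum]
      rw [Finset.mul_sum, ← Finset.sum_sub_distrib]
      refine Finset.sum_congr rfl fun r _ => ?_
      rw [ind_apply]
      by_cases hr : T j r ∈ shiftedB m (M - m) x <;> simp [hr]
      ring
    rw [h2]
    have h3 := Real.add_one_le_exp (-((1 - Real.exp (-s)) * ε))
    have h4 := wsum_nonneg φ (box d n) hg
    nlinarith [mul_le_mul_of_nonneg_left h0 (sub_nonneg.mpr he), mul_le_mul_of_nonneg_right h3 h4]
  have h5 := (abs_le.mp (Real.abs_exp_sub_one_sub_id_le (x := -s)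
    (abs_le.mpr ⟨by linarith, by linarith⟩))).2
  have h6 : s * ε ≤ s * (ν.real (shiftedB m (M - m) x) + s * ε) := by nlinarith
  exact le_of_mul_le_mul_left h6 hs0

theorem IsTangentFunctional.measure_shiftedB_le (hν : IsTangentFunctional ν φ) (q : ℕ) (x : Pt X) :
    ν.real (shiftedB m q x) ≤ (box d q).card * ν.real (B m x) := by
  have := hν.isProbabilityMeasure
  refine (measureReal_biUnion_finset_le _ _).trans ?_
  rw [← nsmul_eq_mul]
  refine Finset.sum_le_card_nsmul _ _ _ fun l _ => le_of_eq ?_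
  rw [measureReal_def, (hν.invariant l).measure_preimage
    (isClopen_B m x).1.measurableSet.nullMeasurableSet, measureReal_def]

/-- Up to controlled errors, ν(B_m(x)) is exp(∑ φ(T^j x))/Z_m, and ln Z_m is |Λ_m| P by
`pressure_le_press` and `Replaceable.log_Z_le`. -/
theorem Replaceable.weakGibbs_bound (h : Replaceable φ m M η) (hmM : m ≤ M)
    (hv : ∀ x y : Pt X, Set.EqOn x.1 y.1 (box d m : Set (Lattice d)) →
      birk φ (box d m) x ≤ birk φ (box d m) y + v) (hη : 0 ≤ η)
    (hν : IsTangentFunctional ν φ) (x : Pt X) :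
    0 < ν (B m x) ∧
      |((box d m).card : ℝ)⁻¹ * Real.log (ν.real (B m x)) -
        empiricalMean m x (φ - ContinuousMap.const _ (pressure φ))| ≤
      ((box d m).card : ℝ)⁻¹ * (2 * η + v + Real.log (box d (M - m)).card +
        (|pressure φ| + ‖φ‖) * ((box d M).card - (box d m).card)) := by
  have := hν.isProbabilityMeasure
  have : Nonempty (Pt X) := ⟨x⟩
  have hm : (0 : ℝ) < (box d m).card := by exact_mod_cast card_box_pos d m
  have hq : (1 : ℝ) ≤ (box d (M - m)).card := by exact_mod_cast card_box_pos d (M - m)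
  have hMm : (0 : ℝ) ≤ (box d M).card - (box d m).card := by
    rw [sub_nonneg]; exact_mod_cast Finset.card_le_card (box_mono hmM)
  have hZm := Z_pos φ (box d m)
  have hup := h.measure_B_le hmM hν x
  have hlow := (h.le_measure_shiftedB hmM hν x).trans (hν.measure_shiftedB_le (M - m) x)
  have hpos : 0 < ν.real (B m x) := by
    have h1 : 0 < Real.exp (birk φ (box d m) x - η) / Z φ (box d m) := by positivity
    exact pos_of_mul_pos_right (h1.trans_le hlow) (by positivity)
  refine ⟨?_, ?_⟩
  · rw [measureReal_def] at hpos
    exact (ENNReal.toReal_pos_iff.mp hpos).1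
  have hP1 : (box d m).card * pressure φ ≤ Real.log (Z φ (box d m)) := by
    have := pressure_le_press φ m
    rwa [press, le_inv_mul_iff₀ hm] at this
  have hP2 := h.log_Z_le hmM hv
  have hU : Real.log (ν.real (B m x)) ≤ η + v + birk φ (box d m) x -
      Real.log (Z φ (box d m)) := by
    have h1 := Real.log_le_log hpos hup
    rw [Real.log_div (Real.exp_pos _).ne' hZm.ne', Real.log_exp] at h1
    have h3 := hv _ _ (rep_eqOn φ (box d m) x)
    linarith
  have hL : birk φ (box d m) x - η - Real.log (box d (M - m)).card -
      Real.log (Z φ (box d m)) ≤ Real.log (ν.real (B m x)) := by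
    have h1 := Real.log_le_log (by positivity) hlow
    rw [Real.log_div (Real.exp_pos _).ne' hZm.ne', Real.log_exp,
      Real.log_mul (by positivity) hpos.ne'] at h1
    linarith
  have hemp : empiricalMean m x (φ - ContinuousMap.const _ (pressure φ)) =
      ((box d m).card : ℝ)⁻¹ * (birk φ (box d m) x - (box d m).card * pressure φ) := by
    simp [empiricalMean, birk]
  rw [hemp, ← mul_sub, abs_mul, abs_of_pos (inv_pos.mpr hm)]
  refine mul_le_mul_of_nonneg_left ?_ (inv_pos.mpr hm).le
  have hq0 := Real.log_nonneg hq
  have h3 : ((box d M).card - (box d m).card : ℝ) * pressure φ ≤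
      |pressure φ| * ((box d M).card - (box d m).card) := by
    rw [mul_comm]; exact mul_le_mul_of_nonneg_right (le_abs_self _) hMm
  have h4 : 0 ≤ (|pressure φ| + ‖φ‖) * ((box d M).card - (box d m).card) := by positivity
  have h5 := norm_nonneg φ
  rw [abs_le]
  constructor <;> nlinarith

end Bounds

end Replacement

/-! ### The errors are negligible compared with the volume. -/

section Limits

theorem tendsto_card_add_mul {q : ℕ → ℕ}
    (hq : Tendsto (fun m : ℕ => (q m : ℝ) / (m : ℝ)) atTop (𝓝 0))
    (d c : ℕ) : Tendsto (fun m => ((box d (m + c * q m)).card : ℝ) / (box d m).card) atTop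
      (𝓝 1) := by
  refine tendsto_card_box_ratio (b := fun m => m) ?_
  have h1 : Tendsto (fun m : ℕ => 1 + 2 * c * (q m : ℝ) / (2 * m + 1)) atTop (𝓝 (1 + 0)) := by
    refine tendsto_const_nhds.add ?_
    have h2 := hq.const_mul (2 * (c : ℝ))
    rw [mul_zero] at h2
    refine tendsto_of_tendsto_of_tendsto_of_le_of_le' tendsto_const_nhds h2
      (Eventually.of_forall fun m => by positivity) ?_
    filter_upwards [eventually_ge_atTop 1] with m hm
    have hm' : (1 : ℝ) ≤ m := by exact_mod_cast hm
    rw [← mul_div_assoc]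
    gcongr
    linarith
  rw [add_zero] at h1
  refine h1.congr fun m => ?_
  push_cast
  field_simp
  ring

theorem tendsto_log_card_box {q : ℕ → ℕ}
    (hq : Tendsto (fun m : ℕ => (q m : ℝ) / (m : ℝ)) atTop (𝓝 0)) (d c : ℕ) :
    Tendsto (fun m => ((box d m).card : ℝ)⁻¹ * Real.log (box d (c * q m)).card) atTop (𝓝 0) := by
  have h2 := hq.const_mul (2 * d * c : ℝ)
  rw [mul_zero] at h2
  refine tendsto_of_tendsto_of_tendsto_of_le_of_le' tendsto_const_nhds h2
    (Eventually.of_forall fun m => ?_) ?_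
  · refine mul_nonneg (by positivity) (Real.log_nonneg ?_)
    exact_mod_cast card_box_pos d _
  · filter_upwards [eventually_ge_atTop 1] with m hm
    have hm' : (1 : ℝ) ≤ m := by exact_mod_cast hm
    -- For d = 0 the boxes do not grow with m, but they are single points and the logarithm
    -- vanishes.
    rcases Nat.eq_zero_or_pos d with rfl | hd
    · simp [card_box]
    · have h3 : (m : ℝ) ≤ (box d m).card := by
        rw [card_box]
        push_cast
        have h4 : (2 * (m : ℝ) + 1) ^ 1 ≤ (2 * (m : ℝ) + 1) ^ d :=
          pow_le_pow_right₀ (by linarith) hd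
        linarith
      have h5 : Real.log (box d (c * q m)).card ≤ 2 * d * c * q m := by
        rw [card_box]
        push_cast
        rw [Real.log_pow]
        have h6 := Real.log_le_sub_one_of_pos (x := 2 * (c * (q m : ℝ)) + 1) (by positivity)
        have h7 := mul_le_mul_of_nonneg_left h6 (Nat.cast_nonneg (α := ℝ) d)
        linarith
      calc ((box d m).card : ℝ)⁻¹ * Real.log (box d (c * q m)).card
          ≤ (m : ℝ)⁻¹ * (2 * d * c * q m) := by
            gcongr
        _ = 2 * d * c * (q m / m) := by field_simp

variable {d : ℕ} {A : Type*} [TopologicalSpace A] {X : ShiftSpace d A} [Finite A]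
  [DiscreteTopology A] [MeasurableSpace A] [BorelSpace A]

theorem IsTangentFunctional.isWeakGibbs {φ : C(Pt X, ℝ)} {ν : Measure (Pt X)}
    (hν : IsTangentFunctional ν φ) {q : ℕ → ℕ} (c : ℕ) {η v : ℕ → ℝ}
    (hq : Tendsto (fun m : ℕ => (q m : ℝ) / (m : ℝ)) atTop (𝓝 0))
    (hrep : ∀ᶠ m in atTop, Replaceable φ m (m + c * q m) (η m)) (hη0 : ∀ m, 0 ≤ η m)
    (hη : Tendsto (fun m => ((box d m).card : ℝ)⁻¹ * η m) atTop (𝓝 0))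
    (hv : ∀ m, ∀ x y : Pt X, Set.EqOn x.1 y.1 (box d m : Set (Lattice d)) →
      birk φ (box d m) x ≤ birk φ (box d m) y + v m)
    (hvt : Tendsto (fun m => ((box d m).card : ℝ)⁻¹ * v m) atTop (𝓝 0)) :
    IsWeakGibbs ν (φ - ContinuousMap.const _ (pressure φ)) := by
  refine ⟨hν.isProbabilityMeasure, fun δ hδ => ?_⟩
  have := hν.isProbabilityMeasure
  have : Nonempty (Pt X) := nonempty_of_isProbabilityMeasure ν
  have h1 : Tendsto (fun m => 2 * (((box d m).card : ℝ)⁻¹ * η m) + ((box d m).card : ℝ)⁻¹ * v m +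
      ((box d m).card : ℝ)⁻¹ * Real.log (box d (c * q m)).card + (|pressure φ| + ‖φ‖) *
        (((box d (m + c * q m)).card : ℝ) / (box d m).card - 1)) atTop
      (𝓝 (2 * 0 + 0 + 0 + (|pressure φ| + ‖φ‖) * (1 - 1))) :=
    (((hη.const_mul 2).add hvt).add (tendsto_log_card_box hq d c)).add
      (((tendsto_card_add_mul hq d c).sub_const 1).const_mul _)
  simp only [mul_zero, add_zero, sub_self] at h1
  obtain ⟨N, hN⟩ := eventually_atTop.mp ((h1.eventually_le_const hδ).and hrep)
  refine ⟨N, fun m hm x => ?_⟩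
  obtain ⟨h2, h3⟩ := hN m hm
  have hm0 : (0 : ℝ) < (box d m).card := by exact_mod_cast card_box_pos d m
  refine (h3.weakGibbs_bound (Nat.le_add_right _ _) (hv m) (hη0 m) hν x).imp id fun h4 =>
    h4.trans (le_trans (le_of_eq ?_) h2)
  rw [Nat.add_sub_cancel_left]
  field_simp

end Limits

/-! ### Replaceability from an explicit insertion of patterns. -/

section Insertion

universe u

variable {d : ℕ} {A : Type u} [TopologicalSpace A] {X : ShiftSpace d A} [Finite A]

/-- Λ_n is decomposed twice: for x into L, R, j+Λ_m and a rest, for z into L, R−a, i+Λ_m and a rest.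
The covered parts have equal size, so each rest has at most b sites and costs at most b‖φ‖. -/
theorem birk_insertion_le {φ : C(Pt X, ℝ)} {n m b : ℕ} {j i a : Lattice d} {e v : ℝ}
    {L R : Finset (Lattice d)} (hL : L ⊆ box d n) (hR : R ⊆ box d n) (hLR : Disjoint L R)
    (hj : tbox j m ⊆ box d n) (hLj : Disjoint L (tbox j m)) (hRj : Disjoint R (tbox j m))
    (hb : (box d n \ (L ∪ R ∪ tbox j m)).card ≤ b)
    (hRa : R.map (addRightEmbedding (-a)) ⊆ box d n)
    (hLRa : Disjoint L (R.map (addRightEmbedding (-a)))) (hi : tbox i m ⊆ box d n)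
    (hLi : Disjoint L (tbox i m)) (hRi : Disjoint (R.map (addRightEmbedding (-a))) (tbox i m))
    {x y z : Pt X} (hLe : birk φ L x ≤ birk φ L z + e) (hRe : birk φ R x ≤ birk φ R (T (-a) z) + e)
    (hye : birk φ (box d m) y ≤ birk φ (box d m) (T i z) + v) :
    birk φ (box d n) x + birk φ (box d m) y ≤
      birk φ (box d n) z + birk φ (box d m) (T j x) + (2 * e + v + 2 * b * ‖φ‖) := by
  classical
  have hU : L ∪ R ∪ tbox j m ⊆ box d n := Finset.union_subset (Finset.union_subset hL hR) hj
  have hU' : L ∪ R.map (addRightEmbedding (-a)) ∪ tbox i m ⊆ box d n :=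
    Finset.union_subset (Finset.union_subset hL hRa) hi
  have hd : Disjoint (L ∪ R) (tbox j m) := Finset.disjoint_union_left.mpr ⟨hLj, hRj⟩
  have hd' : Disjoint (L ∪ R.map (addRightEmbedding (-a))) (tbox i m) :=
    Finset.disjoint_union_left.mpr ⟨hLi, hRi⟩
  have hcard : (L ∪ R.map (addRightEmbedding (-a)) ∪ tbox i m).card =
      (L ∪ R ∪ tbox j m).card := by
    rw [Finset.card_union_of_disjoint hd, Finset.card_union_of_disjoint hd',
      Finset.card_union_of_disjoint hLR, Finset.card_union_of_disjoint hLRa, Finset.card_map,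
      card_tbox, card_tbox]
  have hb' : ((box d n).card : ℝ) - (L ∪ R ∪ tbox j m).card ≤ b := by
    rw [← Finset.cast_card_sdiff hU]; exact_mod_cast hb
  have h1 := (abs_le.mp (birk_le_add_of_subset φ hU x)).2
  have h2 := (abs_le.mp (birk_le_add_of_subset φ hU' z)).1
  rw [hcard] at h2
  rw [birk_union φ hd, birk_union φ hLR, birk_tbox] at h1
  rw [birk_union φ hd', birk_union φ hLRa, birk_tbox, birk_map] at h2
  have h3 := mul_le_mul_of_nonneg_right hb' (norm_nonneg φ)
  linarith

/-- `z` arises from `x` by the insertion of the pattern of `y` on `Λ_m` around `j + l`, where the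
sites of `R` are translated by `-a`, with the error `e` for the energies of `L` and `R`. -/
structure IsInsertion (φ : C(Pt X, ℝ)) (n m : ℕ) (j l a : Lattice d) (e : ℝ)
    (L R : Finset (Lattice d)) (x y z : Pt X) : Prop where
  eqOn_center : Set.EqOn (T (l + j) z).1 y.1 (box d m : Set (Lattice d))
  eqOn_left : Set.EqOn z.1 x.1 (L : Set (Lattice d))
  eqOn_right : Set.EqOn (T (-a) z).1 x.1 (R : Set (Lattice d))
  birk_left : birk φ L x ≤ birk φ L z + e
  birk_right : birk φ R x ≤ birk φ R (T (-a) z) + e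
  map_subset : R.map (addRightEmbedding (-a)) ⊆ box d n
  disjoint_map : Disjoint L (R.map (addRightEmbedding (-a)))
  disjoint_left : Disjoint L (tbox (l + j) m)
  disjoint_right : Disjoint (R.map (addRightEmbedding (-a))) (tbox (l + j) m)

/-- The code records l, a and the pattern of x on the sites covered neither by L, R nor by j+Λ_m.
Given these, z shows y at the inserted box, and x on L and, after translation, on R. -/
theorem replaceable_of_isInsertion {φ : C(Pt X, ℝ)} {m M b Q : ℕ} (hmM : m ≤ M) {e v : ℝ}
    (H : ∀ n, ∀ j ∈ inner d n M, ∃ L R : Finset (Lattice d), L ⊆ box d n ∧ R ⊆ box d n ∧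
      Disjoint L R ∧ Disjoint L (tbox j m) ∧ Disjoint R (tbox j m) ∧
      (box d n \ (L ∪ R ∪ tbox j m)).card ≤ b ∧
      ∀ x y : Pt X, ∃ z : Pt X, ∃ l ∈ box d (M - m), ∃ a ∈ box d Q,
        Set.EqOn z.1 x.1 (past M j ∩ box d n) ∧ IsInsertion φ n m j l a e L R x y z)
    (hv : ∀ x y : Pt X, Set.EqOn x.1 y.1 (box d m : Set (Lattice d)) →
      birk φ (box d m) x ≤ birk φ (box d m) y + v) :
    Replaceable φ m M (Real.log (box d (M - m)).card + Real.log (box d Q).card +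
      b * Real.log (Nat.card A) + (2 * e + v + 2 * b * ‖φ‖)) := by
  classical
  have := Fintype.ofFinite A
  intro n j hj
  obtain ⟨L, R, hL, hR, hLR, hLj, hRj, hb, H⟩ := H n j hj
  choose z l hl a ha hpast hins using H
  have hjn : tbox j m ⊆ box d n := (tbox_mono j hmM).trans (tbox_subset_of_mem_inner hj)
  have hln : ∀ x y, tbox (l x y + j) m ⊆ box d n := by
    intro x y k hk
    refine tbox_subset_of_mem_inner hj (mem_tbox.mpr fun c => ?_)
    have h1 := mem_tbox.mp hk c
    have h2 := mem_box.mp (hl x y) c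
    rw [Pi.add_apply] at h1
    rw [abs_le] at h1 h2 ⊢
    omega
  set Bd := box d n \ (L ∪ R ∪ tbox j m) with hBd
  refine ⟨box d (M - m) × box d Q × (Bd → A), inferInstance, 2 * e + v + 2 * b * ‖φ‖, z,
    fun x y => (⟨l x y, hl x y⟩, ⟨a x y, ha x y⟩, Bd.restrict x.1), ?_, hpast, ?_, ?_, ?_⟩
  · rw [Real.exp_add _ (2 * e + v + 2 * b * ‖φ‖)]
    refine mul_le_mul_of_nonneg_right ?_ (Real.exp_pos _).le
    rw [Real.exp_add, Real.exp_add, Real.exp_log (by exact_mod_cast card_box_pos d (M - m)),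
      Real.exp_log (by exact_mod_cast card_box_pos d Q)]
    rw [Fintype.card_prod, Fintype.card_prod, Fintype.card_fun, Fintype.card_coe, Fintype.card_coe,
      Fintype.card_coe, ← Nat.card_eq_fintype_card, ← mul_assoc]
    push_cast
    refine mul_le_mul_of_nonneg_left ?_ (by positivity)
    -- For an empty alphabet `Real.log 0 = 0` makes the right side 1, while the number of patterns
    -- is a power of 0, hence at most 1.
    rcases Nat.eq_zero_or_pos (Nat.card A) with h0 | h0
    · rw [h0, Nat.cast_zero, Real.log_zero, mul_zero, Real.exp_zero]
      exact pow_le_one₀ le_rfl zero_le_one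
    · rw [Real.exp_nat_mul, Real.exp_log (by exact_mod_cast h0)]
      exact pow_le_pow_right₀ (by exact_mod_cast h0) hb
  · intro x y
    exact ⟨l x y, hl x y, (hins x y).eqOn_center⟩
  · intro x y
    have h := hins x y
    exact birk_insertion_le hL hR hLR hjn hLj hRj hb h.map_subset h.disjoint_map (hln x y)
      h.disjoint_left h.disjoint_right h.birk_left h.birk_right
      (hv _ _ h.eqOn_center.symm)
  · intro x y x' y' hz hc
    simp only [Prod.mk.injEq, Subtype.mk.injEq] at hc
    obtain ⟨hcl, hca, hcB⟩ := hc
    have h := hins x y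
    have h' := hins x' y'
    refine ⟨fun k hk => ?_, ?_⟩
    · by_cases hkL : k ∈ L
      · rw [← h.eqOn_left hkL, ← h'.eqOn_left hkL]
        exact hz hk.1
      by_cases hkR : k ∈ R
      · rw [← h.eqOn_right hkR, ← h'.eqOn_right hkR, hca, T_apply, T_apply]
        refine hz (h'.map_subset ?_)
        exact Finset.mem_map_of_mem (addRightEmbedding (-a x' y')) hkR
      · refine restrict_eq_iff.mp hcB ?_
        have h1 := hk.1
        have h2 := hk.2
        simp only [Finset.mem_coe] at h1 h2
        simp [hBd, h1, hkL, hkR, h2]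
    · refine h.eqOn_center.symm.trans (Set.EqOn.trans ?_ h'.eqOn_center)
      rw [hcl]
      exact eqOn_T_box_iff.mpr (hz.mono (hln x' y'))

end Insertion

open scoped ENNReal

/-! ### Energy estimates for absolutely summable potentials. -/

section Energy

variable {d : ℕ} {A : Type*} [TopologicalSpace A] {X : ShiftSpace d A} [Finite A]

/-- The translation `S ↦ S + a` of finite sets of sites. -/
def translate (a : Lattice d) : Finset (Lattice d) ≃ Finset (Lattice d) :=
  (Equiv.addRight a).finsetCongr

theorem mem_translate {a k : Lattice d} {S : Finset (Lattice d)} :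
    k ∈ translate a S ↔ k - a ∈ S := by
  simp [translate, sub_eq_add_neg]

theorem card_translate (a : Lattice d) (S : Finset (Lattice d)) :
    (translate a S).card = S.card := by
  simp [translate]

namespace Potential

variable (Φ : Potential X)

theorem toFun_T (S : Finset (Lattice d)) (a : Lattice d) (x : Pt X) :
    Φ.toFun S (T a x) = Φ.toFun (translate a S) x := by
  rw [Φ.translation]
  rfl

/-- The norm of the interaction of a finite set of sites. -/
def weight (S : Finset (Lattice d)) : ℝ≥0∞ := ‖Φ.toFun S‖ₑ

theorem weight_translate (a : Lattice d) (S : Finset (Lattice d)) :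
    Φ.weight (translate a S) = Φ.weight S := by
  have key : ∀ (a : Lattice d) (S : Finset (Lattice d)),
      ‖Φ.toFun (translate a S)‖ ≤ ‖Φ.toFun S‖ := by
    intro a S
    refine (ContinuousMap.norm_le _ (norm_nonneg _)).mpr fun x => ?_
    rw [← toFun_T]
    exact (Φ.toFun S).norm_coe_le_norm _
  have h2 : translate (-a) (translate a S) = S := by
    ext k
    simp [mem_translate]
  rw [weight, weight, ← ofReal_norm, ← ofReal_norm]
  congr 1
  refine le_antisymm (key a S) ?_
  have := key (-a) (translate a S)
  rwa [h2] at this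

theorem tsum_translate (a : Lattice d) (f : Finset (Lattice d) → ℝ≥0∞) :
    ∑' S, f (translate a S) = ∑' S, f S := (translate a).tsum_eq f

open Classical in
/-- The total weight of the finite sets which contain `0`. -/
def originWeight : ℝ≥0∞ := ∑' S, if (0 : Lattice d) ∈ S then Φ.weight S else 0

theorem originWeight_lt_top : Φ.originWeight < ∞ := by
  have h1 := Φ.summable
  have h2 : ∑' S : {S : Finset (Lattice d) // 0 ∈ S}, Φ.weight S.1 ≠ ∞ := by
    have h3 := h1.tsum_ofReal_ne_top
    simpa only [weight, ← ofReal_norm] using h3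
  rw [lt_top_iff_ne_top]
  refine ne_of_eq_of_ne (Eq.trans (tsum_congr fun S => ?_)
    (tsum_subtype {S : Finset (Lattice d) | 0 ∈ S} Φ.weight).symm) h2
  simp [Set.indicator_apply]

open Classical in
/-- The total weight of the finite sets which contain a site of `Q` and a site outside of `Q`,
counted with the number of sites in `Q`. -/
def boundary (Q : Finset (Lattice d)) : ℝ≥0∞ :=
  ∑ k ∈ Q, ∑' S, if k ∈ S ∧ ¬S ⊆ Q then Φ.weight S else 0

theorem phi_T (i : Lattice d) (x : Pt X) : Φ.phi (T i x) =
    ∑' S : {S : Finset (Lattice d) // 0 ∈ S}, Φ.toFun (translate i S.1) x / (S.1.card : ℝ) := by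
  change ∑' S : {S : Finset (Lattice d) // 0 ∈ S}, Φ.toFun S.1 (T i x) / (S.1.card : ℝ) = _
  simp only [toFun_T]

theorem summable_term (i : Lattice d) (x : Pt X) :
    Summable fun S : {S : Finset (Lattice d) // 0 ∈ S} =>
      Φ.toFun (translate i S.1) x / (S.1.card : ℝ) := by
  refine Summable.of_norm_bounded Φ.summable fun S => ?_
  have h1 : (1 : ℝ) ≤ (S.1.card : ℝ) := by
    exact_mod_cast Finset.card_pos.mpr ⟨0, S.2⟩
  rw [norm_div, Real.norm_natCast, ← toFun_T]
  exact (div_le_self (norm_nonneg _) h1).trans ((Φ.toFun S.1).norm_coe_le_norm _)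

open Classical in
-- Interactions of sets inside U cancel by locality. The factor 1/|S| is kept, since it later
-- compensates for the number of sites of S.
theorem enorm_phi_sub_le {U : Set (Lattice d)} (i : Lattice d) {x z : Pt X}
    (h : Set.EqOn x.1 z.1 U) : ‖Φ.phi (T i x) - Φ.phi (T i z)‖ₑ ≤
      2 * ∑' S : Finset (Lattice d),
        if i ∈ S ∧ ¬(S : Set (Lattice d)) ⊆ U then Φ.weight S / S.card else 0 := by
  rw [phi_T, phi_T, ← (Φ.summable_term i x).tsum_sub (Φ.summable_term i z)]
  refine enorm_tsum_le_tsum_enorm.trans ?_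
  rw [← tsum_translate i, ← ENNReal.tsum_mul_left]
  have h1 : ∀ S : {S : Finset (Lattice d) // 0 ∈ S},
      ‖Φ.toFun (translate i S.1) x / (S.1.card : ℝ) -
        Φ.toFun (translate i S.1) z / (S.1.card : ℝ)‖ₑ ≤
      2 * if i ∈ translate i S.1 ∧ ¬(translate i S.1 : Set (Lattice d)) ⊆ U then
        Φ.weight (translate i S.1) / (translate i S.1).card else 0 := by
    intro S
    rw [← sub_div, card_translate]
    have hi : i ∈ translate i S.1 := by rw [mem_translate, sub_self]; exact S.2
    have hS : (S.1.card : ℝ) ≠ 0 := by exact_mod_cast (Finset.card_pos.mpr ⟨0, S.2⟩).ne'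
    by_cases hU : (translate i S.1 : Set (Lattice d)) ⊆ U
    · rw [Φ.isLocal _ x z (h.mono hU)]
      simp
    · rw [if_pos ⟨hi, hU⟩, div_eq_mul_inv, enorm_mul, enorm_inv hS, ← mul_div_assoc,
        ← div_eq_mul_inv]
      have h2 : ‖Φ.toFun (translate i S.1) x - Φ.toFun (translate i S.1) z‖ₑ ≤
          2 * Φ.weight (translate i S.1) := by
        rw [weight, two_mul]
        refine enorm_sub_le.trans (add_le_add ?_ ?_) <;>
        · rw [← ofReal_norm, ← ofReal_norm]
          exact ENNReal.ofReal_le_ofReal ((Φ.toFun _).norm_coe_le_norm _)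
      have h3 : ‖(S.1.card : ℝ)‖ₑ = S.1.card := by simp
      rw [h3]
      gcongr
  refine (ENNReal.tsum_le_tsum h1).trans ?_
  exact ENNReal.tsum_comp_le_tsum_of_injective Subtype.val_injective (fun S => 2 *
    if i ∈ translate i S ∧ ¬(translate i S : Set (Lattice d)) ⊆ U then
        Φ.weight (translate i S) / (translate i S).card else 0)

open Classical in
theorem enorm_birk_sub_le {U : Set (Lattice d)} (V : Finset (Lattice d)) {x z : Pt X}
    (h : Set.EqOn x.1 z.1 U) : ‖birk Φ.phi V x - birk Φ.phi V z‖ₑ ≤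
      2 * ∑ i ∈ V, ∑' S : Finset (Lattice d),
        if i ∈ S ∧ ¬(S : Set (Lattice d)) ⊆ U then Φ.weight S / S.card else 0 := by
  rw [birk, birk, ← Finset.sum_sub_distrib, Finset.mul_sum]
  exact (enorm_sum_le _ _).trans (Finset.sum_le_sum fun i _ => Φ.enorm_phi_sub_le i h)

open Classical in
-- At most |S| sites i ∈ V lie in S, so the weights 1/|S| add up to at most 1: the bound does not
-- grow with V. A set S that meets V and Q is not contained in Q, hence is counted in `boundary Q`;
-- the remaining sets satisfy C.
theorem sum_tsum_le {U : Set (Lattice d)} {V Q : Finset (Lattice d)} (hVQ : Disjoint V Q)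
    (C : Finset (Lattice d) → Prop)
    (hC : ∀ S : Finset (Lattice d), ∀ i ∈ V, i ∈ S → ¬(S : Set (Lattice d)) ⊆ U →
      (∃ k ∈ S, k ∈ Q) ∨ C S) :
    ∑ i ∈ V, ∑' S : Finset (Lattice d),
      (if i ∈ S ∧ ¬(S : Set (Lattice d)) ⊆ U then Φ.weight S / S.card else 0) ≤
      Φ.boundary Q + ∑' S, if C S then Φ.weight S else 0 := by
  rw [boundary, ← Summable.tsum_finsetSum fun _ _ => ENNReal.summable,
    ← Summable.tsum_finsetSum fun _ _ => ENNReal.summable, ← ENNReal.tsum_add]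
  refine ENNReal.tsum_le_tsum fun S => ?_
  by_cases hS : ∃ i ∈ V, i ∈ S ∧ ¬(S : Set (Lattice d)) ⊆ U
  · obtain ⟨i, hiV, hiS, hSU⟩ := hS
    have h1 : ∑ i ∈ V, (if i ∈ S ∧ ¬(S : Set (Lattice d)) ⊆ U then Φ.weight S / S.card else 0) ≤
        Φ.weight S := by
      have h2 : (S.card : ℝ≥0∞) ≠ 0 := by
        exact_mod_cast (Finset.card_pos.mpr ⟨i, hiS⟩).ne'
      calc ∑ i ∈ V, (if i ∈ S ∧ ¬(S : Set (Lattice d)) ⊆ U then Φ.weight S / S.card else 0)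
          ≤ ∑ i ∈ V, (if i ∈ S then Φ.weight S / S.card else 0) := by
            refine Finset.sum_le_sum fun i _ => ?_
            by_cases hi : i ∈ S
            · simp only [hi, true_and, if_true]
              split_ifs
              simp
            · simp [hi]
        _ = (V.filter (· ∈ S)).card * (Φ.weight S / S.card) := by
            rw [← Finset.sum_filter, Finset.sum_const, nsmul_eq_mul]
        _ ≤ S.card * (Φ.weight S / S.card) := by
            gcongr
            intro k hk
            exact (Finset.mem_filter.mp hk).2
        _ = Φ.weight S := ENNReal.mul_div_cancel h2 (ENNReal.natCast_ne_top _)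
    refine h1.trans ?_
    rcases hC S i hiV hiS hSU with ⟨k, hkS, hkQ⟩ | hCS
    · have hSQ : ¬S ⊆ Q := fun h => Finset.disjoint_left.mp hVQ hiV (h hiS)
      refine le_trans ?_ le_self_add
      refine le_trans ?_ (Finset.single_le_sum (f := fun k => if k ∈ S ∧ ¬S ⊆ Q then
        Φ.weight S else 0) (fun _ _ => zero_le) hkQ)
      rw [if_pos ⟨hkS, hSQ⟩]
    · rw [if_pos hCS]
      exact le_add_self
  · push Not at hS
    rw [Finset.sum_eq_zero]
    · exact zero_le
    · intro i hi
      rw [if_neg]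
      rintro ⟨h1, h2⟩
      exact h2 (hS i hi h1)

omit [Finite A] in
theorem birk_le_of_enorm {φ : C(Pt X, ℝ)} {V : Finset (Lattice d)} {x z : Pt X} {b : ℝ≥0∞}
    (hb : b ≠ ∞) (h : ‖birk φ V x - birk φ V z‖ₑ ≤ b) : birk φ V x ≤ birk φ V z + b.toReal := by
  have h1 := ENNReal.toReal_mono hb h
  rw [toReal_enorm, Real.norm_eq_abs] at h1
  linarith [(abs_le.mp h1).2]

open Classical in
theorem boundary_lt_top (Q : Finset (Lattice d)) : Φ.boundary Q < ∞ := by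
  refine ENNReal.sum_lt_top.mpr fun k _ => lt_of_le_of_lt ?_ Φ.originWeight_lt_top
  rw [originWeight, ← tsum_translate k]
  refine ENNReal.tsum_le_tsum fun S => ?_
  simp only [weight_translate, mem_translate, sub_self]
  split_ifs <;> simp_all

theorem boundary_tbox (j : Lattice d) (M : ℕ) : Φ.boundary (tbox j M) = Φ.boundary (box d M) := by
  classical
  rw [boundary, boundary, tbox, Finset.sum_map]
  refine Finset.sum_congr rfl fun k _ => ?_
  rw [← tsum_translate j]
  refine tsum_congr fun S => ?_
  have h1 : translate j S ⊆ (box d M).map (addRightEmbedding j) ↔ S ⊆ box d M := by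
    change S.map _ ⊆ _ ↔ _
    exact Finset.map_subset_map
  simp only [weight_translate, mem_translate, h1, addRightEmbedding_apply, add_sub_cancel_right]

theorem birk_box_le (m : ℕ) {x z : Pt X} (h : Set.EqOn x.1 z.1 (box d m : Set (Lattice d))) :
    birk Φ.phi (box d m) x ≤ birk Φ.phi (box d m) z + (2 * Φ.boundary (box d m)).toReal := by
  classical
  refine birk_le_of_enorm (ENNReal.mul_ne_top ENNReal.ofNat_ne_top (Φ.boundary_lt_top _).ne)
    ((Φ.enorm_birk_sub_le _ h).trans ?_)
  rw [boundary]
  gcongr with i _ S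
  simp only [Finset.coe_subset]
  split_ifs with hS
  · refine ENNReal.div_le_of_le_mul ?_
    refine le_mul_of_one_le_right zero_le ?_
    exact_mod_cast Finset.card_pos.mpr ⟨i, hS.1⟩
  · exact le_rfl

open Classical in
/-- The total weight of the finite sets which contain `0` and are not contained in `Λ_r`. -/
def tail (r : ℕ) : ℝ≥0∞ := ∑' S, if (0 : Lattice d) ∈ S ∧ ¬S ⊆ box d r then Φ.weight S else 0

theorem exists_tail_lt {ε : ℝ≥0∞} (hε : 0 < ε) : ∃ r, Φ.tail r < ε := by
  classical
  have h1 := ENNReal.tendsto_tsum_compl_atTop_zero Φ.originWeight_lt_top.ne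
  obtain ⟨s, hs⟩ := (h1.eventually_lt_const hε).exists
  have h2 : ∃ r : ℕ, ∀ S ∈ s, S ⊆ box d r := by
    -- A crude common radius for finitely many finite sets: the sum of all absolute values of
    -- coordinates.
    refine ⟨∑ S ∈ s, ∑ k ∈ S, ∑ c, (k c).natAbs, fun S hS k hk => mem_box.mpr fun c => ?_⟩
    rw [Int.abs_eq_natAbs]
    have e1 : (k c).natAbs ≤ ∑ c, (k c).natAbs :=
      Finset.single_le_sum (f := fun c => (k c).natAbs) (fun _ _ => Nat.zero_le _)
        (Finset.mem_univ c)
    have e2 : ∑ c, (k c).natAbs ≤ ∑ k ∈ S, ∑ c, (k c).natAbs :=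
      Finset.single_le_sum (f := fun k : Lattice d => ∑ c, (k c).natAbs)
        (fun _ _ => Nat.zero_le _) hk
    have e3 : ∑ k ∈ S, ∑ c, (k c).natAbs ≤ ∑ S ∈ s, ∑ k ∈ S, ∑ c, (k c).natAbs :=
      Finset.single_le_sum (f := fun S : Finset (Lattice d) => ∑ k ∈ S, ∑ c, (k c).natAbs)
        (fun _ _ => Nat.zero_le _) hS
    exact_mod_cast e1.trans (e2.trans e3)
  obtain ⟨r, hr⟩ := h2
  refine ⟨r, lt_of_le_of_lt ?_ hs⟩
  rw [tail]
  have h3 := tsum_subtype {S : Finset (Lattice d) | S ∉ s}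
    (fun S => if (0 : Lattice d) ∈ S then Φ.weight S else 0)
  refine le_trans ?_ h3.symm.le
  refine ENNReal.tsum_le_tsum fun S => ?_
  by_cases hS : S ∈ s
  · simp [hr S hS]
  · rw [Set.indicator_of_mem (show S ∈ {S | S ∉ s} from hS)]
    split_ifs <;> simp_all

/-- If k+Λ_r lies in Λ_M, a set through k that leaves Λ_M also leaves k+Λ_r and falls into the tail.
For the few other sites k all sets through k are counted. -/
theorem boundary_box_le (M r : ℕ) : Φ.boundary (box d M) ≤ (box d M).card * Φ.tail r +
    ((box d M).card - (inner d M r).card : ℕ) * Φ.originWeight := by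
  classical
  have hsub : inner d M r ⊆ box d M := Finset.filter_subset _ _
  rw [boundary, ← Finset.sum_sdiff hsub, add_comm]
  refine add_le_add ?_ ?_
  · refine (Finset.sum_le_card_nsmul _ _ (Φ.tail r) fun k hk => ?_).trans ?_
    · rw [tail, ← tsum_translate k]
      refine ENNReal.tsum_le_tsum fun S => ?_
      simp only [weight_translate, mem_translate, sub_self]
      by_cases hS : S ⊆ box d r
      · have h1 : translate k S ⊆ box d M := by
          refine subset_trans ?_ (tbox_subset_of_mem_inner hk)
          change S.map _ ⊆ (box d r).map _
          exact Finset.map_subset_map.mpr hS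
        simp [h1]
      · simp only [hS, not_false_eq_true, and_true]
        split_ifs <;> simp_all
    · rw [nsmul_eq_mul]
      gcongr
  · rw [← Finset.card_sdiff_of_subset hsub, ← nsmul_eq_mul]
    refine Finset.sum_le_card_nsmul _ _ _ fun k _ => ?_
    rw [← tsum_translate k]
    refine ENNReal.tsum_le_tsum fun S => ?_
    simp only [weight_translate, mem_translate, sub_self]
    split_ifs <;> simp_all

theorem tendsto_boundary_box :
    Tendsto (fun M => (Φ.boundary (box d M)).toReal / (box d M).card) atTop (𝓝 0) := by
  classical
  rw [Metric.tendsto_atTop']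
  intro ε hε
  obtain ⟨r, hr⟩ := Φ.exists_tail_lt (ENNReal.ofReal_pos.mpr (half_pos hε))
  set t := Φ.originWeight
  have htt : t ≠ ∞ := Φ.originWeight_lt_top.ne
  have h1 := (tendsto_boundary d r).mul_const t.toReal
  rw [zero_mul] at h1
  obtain ⟨N, hN⟩ := eventually_atTop.mp (h1.eventually_lt_const (half_pos hε))
  refine ⟨N, fun M hM => ?_⟩
  have hM0 : (0 : ℝ) < (box d M).card := by exact_mod_cast card_box_pos d M
  have hsub : inner d M r ⊆ box d M := Finset.filter_subset _ _
  have h2 := ENNReal.toReal_mono (ENNReal.add_ne_top.mpr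
    ⟨ENNReal.mul_ne_top (ENNReal.natCast_ne_top _) (hr.trans ENNReal.ofReal_lt_top).ne,
      ENNReal.mul_ne_top (ENNReal.natCast_ne_top _) htt⟩) (Φ.boundary_box_le M r)
  rw [ENNReal.toReal_add (ENNReal.mul_ne_top (ENNReal.natCast_ne_top _)
    (hr.trans ENNReal.ofReal_lt_top).ne) (ENNReal.mul_ne_top (ENNReal.natCast_ne_top _) htt),
    ENNReal.toReal_mul, ENNReal.toReal_mul, ENNReal.toReal_natCast, ENNReal.toReal_natCast,
    Nat.cast_sub (Finset.card_le_card hsub)] at h2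
  have h3 : (Φ.tail r).toReal < ε / 2 := by
    rw [← ENNReal.lt_ofReal_iff_toReal_lt (hr.trans ENNReal.ofReal_lt_top).ne]
    exact hr
  rw [Real.dist_0_eq_abs, abs_of_nonneg (by positivity), div_lt_iff₀ hM0]
  have h4 := hN M hM.le
  rw [div_mul_eq_mul_div, div_lt_iff₀ hM0] at h4
  nlinarith

end Potential

end Energy

/-! ### Insertions from the two decoupling conditions, and the conclusion. -/

section Main

variable {d : ℕ} {A : Type*} [TopologicalSpace A] {X : ShiftSpace d A} [Finite A]

/-- The common end of both cases: all contributions to η are o(|Λ_m|), since q_m/m → 0 and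
`boundary` is of lower order than the volume. C bounds the sets that jump over the tile; it is 0 in
case (i) and ‖Φ‖' in case (ii). -/
theorem IsTangentFunctional.isWeakGibbs_of_isInsertion [DiscreteTopology A] [MeasurableSpace A]
    [BorelSpace A] {Φ : Potential X} {ν : Measure (Pt X)} (hν : IsTangentFunctional ν Φ.phi)
    {q : ℕ → ℕ} (hq : Tendsto (fun m : ℕ => (q m : ℝ) / (m : ℝ)) atTop (𝓝 0)) (c : ℕ) {C : ℝ≥0∞}
    (hC : C ≠ ∞) (hC0 : Tendsto (fun m => ((box d m).card : ℝ)⁻¹ * C.toReal) atTop (𝓝 0))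
    (H : ∀ m, 1 ≤ m → ∀ n, ∀ j ∈ inner d n (m + c * q m), ∃ L R : Finset (Lattice d),
      L ⊆ box d n ∧ R ⊆ box d n ∧
      Disjoint L R ∧ Disjoint L (tbox j m) ∧ Disjoint R (tbox j m) ∧
      (box d n \ (L ∪ R ∪ tbox j m)).card ≤ 2 * ((box d (m + c * q m)).card - (box d m).card) ∧
      ∀ x y : Pt X, ∃ z : Pt X, ∃ l ∈ box d (c * q m), ∃ a ∈ box d (c * q m),
        Set.EqOn z.1 x.1 (past (m + c * q m) j ∩ box d n) ∧
        IsInsertion Φ.phi n m j l a (2 * (Φ.boundary (box d (m + c * q m)) + C)).toReal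
          L R x y z) :
    IsWeakGibbs ν (Φ.phi - ContinuousMap.const _ (pressure Φ.phi)) := by
  have := hν.isProbabilityMeasure
  have : Nonempty (Pt X) := nonempty_of_isProbabilityMeasure ν
  have : Nonempty A := ⟨(Classical.arbitrary (Pt X)).1 0⟩
  have hA : 0 ≤ Real.log (Nat.card A) := Real.log_nonneg (by exact_mod_cast Nat.card_pos)
  have hlog : ∀ m, 0 ≤ Real.log (box d m).card := fun m =>
    Real.log_nonneg (by exact_mod_cast card_box_pos d m)
  have hvt : Tendsto (fun m => ((box d m).card : ℝ)⁻¹ * (2 * Φ.boundary (box d m)).toReal) atTop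
      (𝓝 0) := by
    have h1 := Φ.tendsto_boundary_box.const_mul 2
    rw [mul_zero] at h1
    refine h1.congr fun m => ?_
    rw [ENNReal.toReal_mul, ENNReal.toReal_ofNat]
    ring
  refine hν.isWeakGibbs c (v := fun m => (2 * Φ.boundary (box d m)).toReal)
    (η := fun m => Real.log (box d (m + c * q m - m)).card + Real.log (box d (c * q m)).card +
      (2 * ((box d (m + c * q m)).card - (box d m).card) : ℕ) * Real.log (Nat.card A) +
      (2 * (2 * (Φ.boundary (box d (m + c * q m)) + C)).toReal +
        (2 * Φ.boundary (box d m)).toReal +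
        2 * (2 * ((box d (m + c * q m)).card - (box d m).card) : ℕ) * ‖Φ.phi‖)) hq ?_ ?_ ?_
    (fun m x y => Φ.birk_box_le m) hvt
  · filter_upwards [eventually_ge_atTop 1] with m hm
    refine replaceable_of_isInsertion (Nat.le_add_right _ _) ?_ (fun x y => Φ.birk_box_le m)
    rw [Nat.add_sub_cancel_left]
    exact H m hm
  · intro m
    have h1 := hlog (m + c * q m - m)
    have h2 := hlog (c * q m)
    have h3 := norm_nonneg Φ.phi
    positivity
  · have h1 := tendsto_log_card_box hq d c
    have h2 := (tendsto_card_add_mul hq d c).sub_const 1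
    have h3 := ((Φ.tendsto_boundary_box.comp (tendsto_atTop_mono
      (fun m => Nat.le_add_right m (c * q m)) tendsto_id)).mul
      (tendsto_card_add_mul hq d c)).add hC0
    have h4 := (((h1.const_mul 2).add (h2.const_mul (2 * Real.log (Nat.card A)))).add
      (h3.const_mul 4)).add (hvt.add (h2.const_mul (4 * ‖Φ.phi‖)))
    simp only [sub_self, mul_zero, add_zero, zero_mul] at h4
    refine h4.congr fun m => ?_
    have hm : ((box d m).card : ℝ) ≠ 0 := by exact_mod_cast (card_box_pos d m).ne'
    have hM : ((box d (m + c * q m)).card : ℝ) ≠ 0 := by exact_mod_cast (card_box_pos d _).ne'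
    rw [Nat.add_sub_cancel_left, Nat.cast_mul,
      Nat.cast_sub (Finset.card_le_card (box_mono (Nat.le_add_right _ _))), ENNReal.toReal_mul,
      ENNReal.toReal_mul, ENNReal.toReal_add (Φ.boundary_lt_top _).ne hC, ENNReal.toReal_ofNat]
    simp only [Function.comp_apply, Nat.cast_ofNat]
    field_simp
    ring

theorem tbox_add_subset {m M : ℕ} {l j : Lattice d} {q : ℕ} (hl : l ∈ box d q) (h : m + q ≤ M) :
    tbox (l + j) m ⊆ tbox j M := by
  intro k hk
  refine mem_tbox.mpr fun c => ?_
  have h1 := mem_tbox.mp hk c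
  have h2 := mem_box.mp hl c
  rw [Pi.add_apply] at h1
  rw [abs_le] at h1 h2 ⊢
  omega

omit [Finite A] in
theorem neg_mem_box {m : ℕ} {l : Lattice d} (h : l ∈ box d m) : -l ∈ box d m := by
  rw [mem_box] at h ⊢
  simpa using h

theorem Decoupling.isWeakGibbs [DiscreteTopology A] [MeasurableSpace A] [BorelSpace A]
    (hX : Decoupling X) {Φ : Potential X} {ν : Measure (Pt X)}
    (hν : IsTangentFunctional ν Φ.phi) :
    IsWeakGibbs ν (Φ.phi - ContinuousMap.const _ (pressure Φ.phi)) := by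
  classical
  obtain ⟨q, hq, hdec⟩ := hX
  refine hν.isWeakGibbs_of_isInsertion hq 1 (C := 0) ENNReal.zero_ne_top (by simp) ?_
  simp only [one_mul]
  intro m _ n j hj
  set M := m + q m with hM
  have hmM : m ≤ M := Nat.le_add_right _ _
  have hjM := tbox_subset_of_mem_inner hj
  -- Outside j+Λ_M nothing changes or moves: all of it goes into L, while R is empty and a = 0.
  refine ⟨box d n \ tbox j M, ∅, Finset.sdiff_subset, Finset.empty_subset _,
    Finset.disjoint_empty_right _, ?_, Finset.disjoint_empty_left _, ?_, fun x y => ?_⟩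
  · exact Finset.sdiff_disjoint.mono_right (tbox_mono j hmM)
  · have h1 : box d n \ (box d n \ tbox j M ∪ ∅ ∪ tbox j m) ⊆ tbox j M \ tbox j m := by
      intro k hk
      simp only [Finset.union_empty, Finset.mem_sdiff, Finset.mem_union, not_or, not_and,
        not_not] at hk ⊢
      exact ⟨hk.2.1 hk.1, hk.2.2⟩
    refine (Finset.card_le_card h1).trans ?_
    rw [Finset.card_sdiff_of_subset (tbox_mono j hmM), card_tbox, card_tbox]
    omega
  · obtain ⟨z, l, hl, h1, h2⟩ := hdec m (T j x) y
    have hzx : Set.EqOn (T (-j) z).1 x.1 ((tbox j M : Set (Lattice d))ᶜ) := by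
      intro k hk
      have h3 : k - j ∈ ((box d M : Set (Lattice d))ᶜ) := by
        simpa [mem_tbox, mem_box] using hk
      have h4 := h2 h3
      rw [T_apply, sub_add_cancel] at h4
      rw [T_apply, ← sub_eq_add_neg, h4]
    have hl' := neg_mem_box hl
    have hsub : tbox (-l + j) m ⊆ tbox j M := tbox_add_subset hl' le_rfl
    refine ⟨T (-j) z, -l, hl', 0, mem_box.mpr fun c => by simp, ?_, ?_⟩
    · refine hzx.mono fun k hk => ?_
      obtain ⟨⟨i, -, hi, hki⟩, -⟩ := hk
      exact fun h => Finset.disjoint_left.mp hi.disjoint hki h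
    · refine ⟨?_, ?_, by simp, ?_, by simp [birk], by simp, by simp, ?_, by simp⟩
      · rw [T_T, add_neg_cancel_right]
        exact h1
      · exact hzx.mono fun k hk => (Finset.mem_sdiff.mp hk).2
      · refine Potential.birk_le_of_enorm (ENNReal.mul_ne_top ENNReal.ofNat_ne_top
          (ENNReal.add_ne_top.mpr ⟨(Φ.boundary_lt_top _).ne, ENNReal.zero_ne_top⟩)) ?_
        refine (Φ.enorm_birk_sub_le _ hzx.symm).trans ?_
        have h3 := Φ.sum_tsum_le (U := (tbox j M : Set (Lattice d))ᶜ)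
          (Finset.sdiff_disjoint (s := tbox j M) (t := box d n)) (fun _ => False) (by
            intro S i _ _ hSU
            rw [Set.not_subset] at hSU
            obtain ⟨k, hk, hkQ⟩ := hSU
            exact Or.inl ⟨k, hk, by simpa using hkQ⟩)
        simp only [if_false, tsum_zero, Potential.boundary_tbox] at h3
        gcongr
      · exact Finset.sdiff_disjoint.mono_right hsub

theorem mem_box_one {m : ℕ} {k : Lattice 1} :
    k ∈ box 1 m ↔ -(m : ℤ) ≤ k 0 ∧ k 0 ≤ m := by
  rw [mem_box, Fin.forall_fin_one, abs_le]

theorem mem_tbox_one {m : ℕ} {j k : Lattice 1} :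
    k ∈ tbox j m ↔ j 0 - m ≤ k 0 ∧ k 0 ≤ j 0 + m := by
  rw [mem_tbox, Fin.forall_fin_one, abs_le]
  constructor <;> intro h <;> constructor <;> omega

/-- In dimension one the coordinate sum gives the usual order, so a disjoint tile that is not later
lies entirely to the left. -/
theorem lt_of_mem_past {M : ℕ} {j k : Lattice 1} (h : k ∈ past M j) : k 0 < j 0 - M := by
  obtain ⟨i, hi, ⟨c, hc⟩, hk⟩ := h
  rw [mem_tbox_one] at hk
  rw [Fin.fin_one_eq_zero c] at hc
  simp only [Finset.univ_unique, Fin.default_eq_zero, Finset.sum_singleton] at hi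
  rcases abs_cases (i 0 - j 0) with h | h <;> omega

/-- `S` meets both components of the complement of `j + [-M, M]`, and does not meet
`j + [-M, M]`. -/
def IsCrossingAt (j : Lattice 1) (M : ℕ) (S : Finset (Lattice 1)) : Prop :=
  (∀ k ∈ S, k 0 < j 0 - M ∨ j 0 + M < k 0) ∧ (∃ k ∈ S, k 0 < j 0 - M) ∧ ∃ k ∈ S, j 0 + M < k 0

theorem IsCrossingAt.isCrossing {j : Lattice 1} {M : ℕ} (hM : 1 ≤ M) {S : Finset (Lattice 1)}
    (h : IsCrossingAt j M (translate j S)) : IsCrossing S := by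
  obtain ⟨h1, ⟨k, hk, hk'⟩, l, hl, hl'⟩ := h
  rw [mem_translate] at hk hl
  refine ⟨fun i hi => ?_, ⟨k - j, hk, ?_⟩, l - j, hl, ?_⟩
  · have h2 := h1 (i + j) (by rw [mem_translate, add_sub_cancel_right]; exact hi)
    rw [Pi.add_apply] at h2
    omega
  · rw [Pi.sub_apply]; omega
  · rw [Pi.sub_apply]; omega

variable {Y : ShiftSpace 1 A}

open Classical in
/-- The norm `‖Φ‖'`. -/
def Potential.crossWeight (Φ : Potential Y) : ℝ≥0∞ :=
  ∑' S, if IsCrossing S then Φ.weight S else 0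

theorem Potential.CrossSummable.crossWeight_ne_top {Φ : Potential Y} (h : Φ.CrossSummable) :
    Φ.crossWeight ≠ ∞ := by
  classical
  have h2 : ∑' S : {S : Finset (Lattice 1) // IsCrossing S}, Φ.weight S.1 ≠ ∞ := by
    have h3 := Summable.tsum_ofReal_ne_top h
    simpa only [weight, ← ofReal_norm] using h3
  refine ne_of_eq_of_ne (Eq.trans (tsum_congr fun S => ?_)
    (tsum_subtype {S : Finset (Lattice 1) | IsCrossing S} Φ.weight).symm) h2
  simp [Set.indicator_apply]

open Classical in
theorem Potential.tsum_isCrossingAt_le (Φ : Potential Y) (j : Lattice 1) {M : ℕ} (hM : 1 ≤ M) :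
    ∑' S, (if IsCrossingAt j M S then Φ.weight S else 0) ≤ Φ.crossWeight := by
  rw [← tsum_translate j, crossWeight]
  refine ENNReal.tsum_le_tsum fun S => ?_
  rw [weight_translate]
  by_cases h : IsCrossingAt j M (translate j S)
  · rw [if_pos h, if_pos (h.isCrossing hM)]
  · rw [if_neg h]
    exact zero_le

theorem Potential.birk_le_of_isCrossingAt {Φ : Potential Y} (hΦ : Φ.CrossSummable) {j : Lattice 1}
    {M : ℕ} (hM : 1 ≤ M) {U : Set (Lattice 1)} {V : Finset (Lattice 1)} (hV : Disjoint V (tbox j M))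
    (hC : ∀ S : Finset (Lattice 1), ∀ i ∈ V, i ∈ S → ¬(S : Set (Lattice 1)) ⊆ U →
      (∃ k ∈ S, k ∈ tbox j M) ∨ IsCrossingAt j M S) {x z : Pt Y} (h : Set.EqOn x.1 z.1 U) :
    birk Φ.phi V x ≤ birk Φ.phi V z + (2 * (Φ.boundary (box 1 M) + Φ.crossWeight)).toReal := by
  classical
  refine Potential.birk_le_of_enorm (ENNReal.mul_ne_top ENNReal.ofNat_ne_top
    (ENNReal.add_ne_top.mpr ⟨(Φ.boundary_lt_top _).ne, hΦ.crossWeight_ne_top⟩))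
    ((Φ.enorm_birk_sub_le _ h).trans ?_)
  have h1 := Φ.sum_tsum_le hV (IsCrossingAt j M) hC
  rw [Potential.boundary_tbox] at h1
  have h2 := Φ.tsum_isCrossingAt_le j hM
  gcongr
  exact h1.trans (add_le_add le_rfl h2)

theorem card_filter_lt_le (n p : ℕ) :
    ((box 1 n).filter fun k => (n : ℤ) - p < k 0).card ≤ p := by
  have h : ((box 1 n).filter fun k => (n : ℤ) - p < k 0).card ≤
      (Finset.Ioc ((n : ℤ) - p) n).card := by
    refine Finset.card_le_card_of_injOn (fun k => k 0) ?_ ?_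
    · intro k hk
      have hk := Finset.mem_filter.mp hk
      exact Finset.mem_Ioc.mpr ⟨hk.2, (mem_box_one.mp hk.1).2⟩
    · intro k _ k' _ e
      funext c
      rw [Fin.fin_one_eq_zero c]
      exact e
  simpa using h

theorem OneDecoupling.isWeakGibbs [DiscreteTopology A] [MeasurableSpace A] [BorelSpace A]
    (hY : OneDecoupling Y) {Φ : Potential Y} (hΦ : Φ.CrossSummable) {ν : Measure (Pt Y)}
    (hν : IsTangentFunctional ν Φ.phi) :
    IsWeakGibbs ν (Φ.phi - ContinuousMap.const _ (pressure Φ.phi)) := by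
  classical
  obtain ⟨q, hq, hdec⟩ := hY
  -- With the left part held in place, the centre moves by at most q_m and the right part by at most
  -- 2q_m. A margin of 4q_m leaves room to keep the three parts disjoint.
  refine hν.isWeakGibbs_of_isInsertion hq 4 hΦ.crossWeight_ne_top ?_ ?_
  · have h1 : Tendsto (fun m : ℕ => ((box 1 m).card : ℝ)⁻¹) atTop (𝓝 0) := by
      refine tendsto_inv_atTop_zero.comp (tendsto_natCast_atTop_atTop.comp
        (tendsto_atTop_mono (f := fun m => m) (fun m => ?_) tendsto_id))
      rw [card_box, pow_one]
      omega
    simpa using h1.mul_const Φ.crossWeight.toReal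
  intro m hm n j hj
  set M := m + 4 * q m with hM
  have hmM : m ≤ M := Nat.le_add_right _ _
  have hM1 : 1 ≤ M := hm.trans hmM
  have hjM := tbox_subset_of_mem_inner hj
  have hj1 : -(n : ℤ) ≤ j 0 - M := by
    have h1 : (fun _ => j 0 - M : Lattice 1) ∈ tbox j M := mem_tbox_one.mpr ⟨le_rfl, by omega⟩
    exact (mem_box_one.mp (hjM h1)).1
  have hj2 : j 0 + M ≤ n := by
    have h1 : (fun _ => j 0 + M : Lattice 1) ∈ tbox j M := mem_tbox_one.mpr ⟨by omega, le_rfl⟩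
    exact (mem_box_one.mp (hjM h1)).2
  set L := (box 1 n).filter fun k => k 0 < j 0 - M with hL
  -- The last 2q_m sites of Λ_n are left out, so that the translated right part stays inside Λ_n.
  set R := (box 1 n).filter fun k => j 0 + M < k 0 ∧ k 0 ≤ (n : ℤ) - (2 * q m : ℕ) with hR
  have memL : ∀ {k}, k ∈ L → k 0 < j 0 - M := fun hk => (Finset.mem_filter.mp hk).2
  have memR : ∀ {k}, k ∈ R → j 0 + M < k 0 ∧ k 0 ≤ (n : ℤ) - (2 * q m : ℕ) :=
    fun hk => (Finset.mem_filter.mp hk).2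
  refine ⟨L, R, Finset.filter_subset _ _, Finset.filter_subset _ _, ?_, ?_, ?_, ?_, fun x y => ?_⟩
  · refine Finset.disjoint_left.mpr fun k hk hk' => ?_
    have := memL hk
    have := memR hk'
    omega
  · refine Finset.disjoint_left.mpr fun k hk hk' => ?_
    have := memL hk
    have := mem_tbox_one.mp hk'
    omega
  · refine Finset.disjoint_left.mpr fun k hk hk' => ?_
    have := memR hk
    have := mem_tbox_one.mp hk'
    omega
  · have h1 : box 1 n \ (L ∪ R ∪ tbox j m) ⊆ (tbox j M \ tbox j m) ∪
        (box 1 n).filter fun k => (n : ℤ) - (2 * q m : ℕ) < k 0 := by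
      intro k hk
      simp only [hL, hR, Finset.mem_sdiff, Finset.mem_union, Finset.mem_filter, mem_tbox_one]
        at hk ⊢
      by_contra h
      simp only [hk.1, true_and] at hk h
      omega
    refine (Finset.card_le_card h1).trans ((Finset.card_union_le _ _).trans ?_)
    refine (add_le_add le_rfl (card_filter_lt_le n (2 * q m))).trans ?_
    rw [Finset.card_sdiff_of_subset (tbox_mono j hmM), card_tbox, card_tbox, card_box, card_box,
      pow_one, pow_one]
    omega
  · obtain ⟨lm, hlm, lp, hlp, z, h1, h2, h3⟩ := hdec m (T j x) y (T j x)
    have hlm' := mem_box_one.mp hlm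
    have hlp' := mem_box_one.mp hlp
    -- Translating by `lm - j` undoes the displacement of the left part, which must agree with x as
    -- it contains the past. The centre is then displaced by `-lm`, and the right part carries the
    -- remaining displacement, with a = `lm - lp`.
    have hleft : Set.EqOn (T (lm - j) z).1 x.1 {k | k 0 < j 0 - M} := by
      intro k hk
      have hk' : k 0 < j 0 - M := hk
      have h4 := h2 (show k + (lm - j) ∈ {k : Lattice 1 | k 0 < -(m : ℤ) - (q m : ℤ)} by
        simp only [Set.mem_ofPred_eq, Pi.add_apply, Pi.sub_apply]
        omega)
      rw [T_apply, h4, T_apply, T_apply]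
      exact congrArg x.1 (by abel)
    have hright : Set.EqOn (T (-(lm - lp)) (T (lm - j) z)).1 x.1 {k | j 0 + M < k 0} := by
      intro k hk
      have hk' : j 0 + M < k 0 := hk
      rw [T_T]
      have h4 := h3 (show k + (-(lm - lp) + (lm - j)) ∈
          {k : Lattice 1 | (m : ℤ) + (q m : ℤ) < k 0} by
        simp only [Set.mem_ofPred_eq, Pi.add_apply, Pi.sub_apply, Pi.neg_apply]
        omega)
      rw [T_apply, h4, T_apply, T_apply]
      exact congrArg x.1 (by abel)
    have hLM : Disjoint L (tbox j M) := by
      refine Finset.disjoint_left.mpr fun k hk hk' => ?_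
      have := memL hk
      have := mem_tbox_one.mp hk'
      omega
    have hRM : Disjoint R (tbox j M) := by
      refine Finset.disjoint_left.mpr fun k hk hk' => ?_
      have := memR hk
      have := mem_tbox_one.mp hk'
      omega
    refine ⟨T (lm - j) z, -lm, neg_mem_box (box_mono (by omega) hlm), lm - lp, ?_, ?_, ?_⟩
    · rw [mem_box_one, Pi.sub_apply]
      push_cast
      omega
    · exact hleft.mono fun k hk => lt_of_mem_past hk.1
    · refine ⟨?_, hleft.mono fun k hk => memL hk, hright.mono fun k hk => (memR hk).1,
        ?_, ?_, ?_, ?_, ?_, ?_⟩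
      · rw [T_T, show -lm + j + (lm - j) = 0 by abel, T_zero]
        exact h1
      -- A set that meets L, leaves the left half-line and avoids the tile must reach the other
      -- side, so it is crossing; the estimate for R is symmetric.
      · refine Potential.birk_le_of_isCrossingAt hΦ hM1 hLM ?_ hleft.symm
        intro S i hi hiS hSU
        by_cases hS : ∃ k ∈ S, k ∈ tbox j M
        · exact Or.inl hS
        · refine Or.inr ⟨fun k hk => ?_, ⟨i, hiS, memL hi⟩, ?_⟩
          · by_contra h
            exact hS ⟨k, hk, mem_tbox_one.mpr (by omega)⟩
          · obtain ⟨k, hk, hkU⟩ := Set.not_subset.mp hSU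
            refine ⟨k, hk, ?_⟩
            by_contra h
            have hkU' : ¬k 0 < j 0 - M := hkU
            exact hS ⟨k, hk, mem_tbox_one.mpr (by omega)⟩
      · refine Potential.birk_le_of_isCrossingAt hΦ hM1 hRM ?_ hright.symm
        intro S i hi hiS hSU
        by_cases hS : ∃ k ∈ S, k ∈ tbox j M
        · exact Or.inl hS
        · refine Or.inr ⟨fun k hk => ?_, ?_, ⟨i, hiS, (memR hi).1⟩⟩
          · by_contra h
            exact hS ⟨k, hk, mem_tbox_one.mpr (by omega)⟩
          · obtain ⟨k, hk, hkU⟩ := Set.not_subset.mp hSU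
            refine ⟨k, hk, ?_⟩
            by_contra h
            have hkU' : ¬j 0 + M < k 0 := hkU
            exact hS ⟨k, hk, mem_tbox_one.mpr (by omega)⟩
      · intro k hk
        obtain ⟨i, hi, rfl⟩ := Finset.mem_map.mp hk
        have := memR hi
        rw [mem_box_one, addRightEmbedding_apply, Pi.add_apply, Pi.neg_apply, Pi.sub_apply]
        omega
      · refine Finset.disjoint_left.mpr fun k hk hk' => ?_
        obtain ⟨i, hi, rfl⟩ := Finset.mem_map.mp hk'
        have h4 := memL hk
        have := memR hi
        rw [addRightEmbedding_apply, Pi.add_apply, Pi.neg_apply, Pi.sub_apply] at h4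
        omega
      · refine Finset.disjoint_left.mpr fun k hk hk' => ?_
        have h4 := memL hk
        have h5 := mem_tbox_one.mp hk'
        rw [Pi.add_apply, Pi.neg_apply] at h5
        omega
      · refine Finset.disjoint_left.mpr fun k hk hk' => ?_
        obtain ⟨i, hi, rfl⟩ := Finset.mem_map.mp hk
        have h5 := mem_tbox_one.mp hk'
        have := memR hi
        simp only [addRightEmbedding_apply, Pi.add_apply, Pi.neg_apply, Pi.sub_apply] at h5
        omega

end Main

end

end WeakGibbs

theorem theorem1 {A : Type*} [Finite A] [TopologicalSpace A] [DiscreteTopology A]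
    [MeasurableSpace A] [BorelSpace A] :
    (∀ (d : ℕ) (X : WeakGibbs.ShiftSpace d A), WeakGibbs.Decoupling X →
      ∀ (Φ : WeakGibbs.Potential X) (ν : MeasureTheory.Measure (WeakGibbs.Pt X)),
        WeakGibbs.IsTangentFunctional ν Φ.phi →
          WeakGibbs.IsWeakGibbs ν
            (Φ.phi - ContinuousMap.const _ (WeakGibbs.pressure Φ.phi))) ∧
    (∀ X : WeakGibbs.ShiftSpace 1 A, WeakGibbs.OneDecoupling X →
      ∀ Φ : WeakGibbs.Potential X, Φ.CrossSummable →
        ∀ ν : MeasureTheory.Measure (WeakGibbs.Pt X),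
          WeakGibbs.IsTangentFunctional ν Φ.phi →
            WeakGibbs.IsWeakGibbs ν
              (Φ.phi - ContinuousMap.const _ (WeakGibbs.pressure Φ.phi))) :=
  ⟨fun _ _ hX _ _ hν => hX.isWeakGibbs hν, fun _ hX _ hΦ _ hν => hX.isWeakGibbs hΦ hν⟩
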